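/- **Theorem.** Let $X$ be an infinite-dimensional real Banach space whose dual $X^*$ is separable (in the norm topology). Then the $\ell_1^+$-weakly null index satisfies $I^+_w(X)<\omega_1$, and $I^+_w(X)=\omega^{\alpha}$ for some ordinal $\alpha<\omega_1$. Here the notions are as follows. *Trees.* A tree on a set $A$ is a non-empty set $T$ of non-empty finite sequences in $A$, ordered by "is an initial segment of". Put $D(T)=\{x\in T: x<y\text{ for some }y\in T\}$, $T^0=T$, $T^{\alpha+1}=D(T^\alpha)$, and $T^\alpha=\bigcap_{\beta<\alpha}T^\beta$ for limit $\alpha$. The order $o(T)$ is the least $\alpha$ with $T^\alpha=\emptyset$ if there is such an $\alpha<\omega_1$, and $\omega_1$ otherwise. *The trees $T(\alpha,s)$, $1\le\alpha<\omega_1$.* Fix, for each limit ordinal $\alpha<\omega_1$, a sequence of successor ordinals $(\alpha_n)$ strictly increasing to $\alpha$ (the theorem holds for every such choice). $T(1,s)$ is an infinite sequence of incomparable nodes; $T(\alpha+1,s)$ is an infinite sequence of incomparable nodes with a copy of $T(\alpha,s)$ after each of them; for limit $\alpha$, $T(\alpha,s)$ is the disjoint union of copies of $T(\alpha_n,s)$,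 $n\in\mathbb N$. A tree $T$ on $X$ is said to be isomorphic to $T(\alpha,s)$ if it is order isomorphic to it and, for $k\ge2$, $(x_1,\dots,x_k)\in T$ implies $(x_1,\dots,x_{k-1})\in T$. An $s$-node of $T$ is the set of initial (minimal) nodes of $T$, or the set of immediate successors of a non-terminal node of $T$; if an $s$-node is enumerated without repetition as $z^i=(x_1,\dots,x_k,y_i)$, $i\ge1$ (where $k=0$ for initial nodes), then $(y_i)_{i\ge1}$ is called an $s$-subsequence of $T$. *The index.* A weakly null tree on $X$ is a tree on $X$ isomorphic to $T(\alpha,s)$ for some $1\le\alpha<\omega_1$, all of whose $s$-subsequences converge weakly to $0$. For $K\ge1$, a sequence $(x_i)_1^m$ in $X$ is an $\ell_1^+$-$K$-sequence if $\|x_i\|=1$ for all $i$, it is $K$-basic (that is, $\|\sum_1^n a_ix_i\|\le K\|\sum_1^m a_ix_i\|$ for all real $(a_i)$ and $n\le m$), and $\frac1K\sum_1^m a_i\le\|\sum_1^m a_ix_i\|$ whenever all $a_i\ge0$. An $\ell_1^+$-$K$-weakly null tree is a weakly null tree on $X$ each of whose nodes is an $\ell_1^+$-$K$-sequence. Finally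 $$I^+_w(X)=\sup_{K\ge1}\ \sup\{o(T): T\text{ is an }\ell_1^+\text{-}K\text{-weakly null tree on }X\},$$ with $\sup\emptyset=0$. -/

import Mathlib

open scoped Ordinal

namespace WeaklyNullIndex

/-! ### Trees of finite sequences

A node is a non-empty finite sequence, written as a list, and the tree order is
"is an initial segment of", i.e. `l <+: l'`. -/

section Trees

variable {A : Type*}

/-- A tree on the set `A`: a non-empty set of non-empty finite sequences in `A`, ordered by
the initial segment relation. -/
def IsTreeOn (T : Set (List A)) : Prop :=
  T.Nonempty ∧ ([] : List A) ∉ T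

/-- The derived tree: the nodes that have a strict successor in the tree. -/
def derived (T : Set (List A)) : Set (List A) :=
  {x | x ∈ T ∧ ∃ y ∈ T, x <+: y ∧ x ≠ y}

/-- The iterated derived trees: `T⁰ = T`, `Tᵅ⁺¹ = D(Tᵅ)`, and intersections at limits. -/
noncomputable def iterDerived (T : Set (List A)) (α : Ordinal.{0}) : Set (List A) :=
  Ordinal.limitRecOn α T (fun _ S => derived S)
    (fun α _ S => {x | ∀ (β : Ordinal.{0}) (hβ : β < α), x ∈ S β hβ})

open Classical in
/-- The order of a tree: the least `α` with `Tᵅ = ∅` if there is such an `α < ω₁`,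
and `ω₁` otherwise. -/
noncomputable def order (T : Set (List A)) : Ordinal.{0} :=
  if ∃ α < ω₁, iterDerived T α = ∅ then sInf {α | iterDerived T α = ∅} else ω₁

/-- `z` is an initial (minimal) node of `T`. -/
def IsInitialNode (T : Set (List A)) (z : List A) : Prop :=
  z ∈ T ∧ ∀ y ∈ T, y <+: z → y = z

/-- `w` is an immediate successor of the node `z` in `T`. -/
def IsImmediateSucc (T : Set (List A)) (z w : List A) : Prop :=
  z ∈ T ∧ w ∈ T ∧ z <+: w ∧ z ≠ w ∧ ∀ y ∈ T, z <+: y → y <+: w → y = z ∨ y = w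

/-- Two trees of finite sequences are isomorphic: there is an order isomorphism for the
initial segment orders. -/
def TreeIso {B : Type*} (T : Set (List A)) (T' : Set (List B)) : Prop :=
  ∃ f : T ≃ T', ∀ x y : T, x.1 <+: y.1 ↔ (f x).1 <+: (f y).1

/-- An `s`-node of `T`: the set of all initial nodes, or the set of all immediate successors
of a non-terminal node. -/
def IsSNode (T : Set (List A)) (S : Set (List A)) : Prop :=
  S = {w | IsInitialNode T w} ∨ ∃ z ∈ derived T, S = {w | IsImmediateSucc T z w}

/-- `(y i)` is an `s`-subsequence of `T`: some `s`-node `S` of `T` is enumerated bijectively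
as `zⁱ = (x₁, …, x_k, y i)`, where `p = (x₁, …, x_k)` may be empty. (Every enumeration of the
`s`-node is admitted; weak convergence does not depend on the enumeration.) -/
def IsSSubsequence (T : Set (List A)) (y : ℕ → A) : Prop :=
  ∃ (S : Set (List A)) (p : List A), IsSNode T S ∧
    Set.BijOn (fun i => p ++ [y i]) Set.univ S

end Trees

/-! ### The trees `T(α, s)` -/

/-- A choice, for every countable limit ordinal `α`, of a sequence of successor ordinals
strictly increasing to `α`. -/
structure LimitSequences where
  seq : Ordinal.{0} → ℕ → Ordinal.{0}
  strictMono : ∀ α, Order.IsSuccLimit α → α < ω₁ → StrictMono (seq α)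
  isSucc : ∀ α, Order.IsSuccLimit α → α < ω₁ → ∀ n, ∃ β, seq α n = β + 1
  isLUB : ∀ α, Order.IsSuccLimit α → α < ω₁ → IsLUB (Set.range (seq α)) α

/-- The tree `T(α, s)`, realised as a tree on `ℕ`.
* `T(0, s)` is empty (and is not used as a tree), so that `T(1, s)` is a sequence of
  incomparable nodes `[0], [1], …`;
* `T(α + 1, s)` is a sequence of incomparable nodes with a copy of `T(α, s)` after each;
* for a limit `α`, `T(α, s)` is the disjoint union over `n` of copies of `T(αₙ, s)`, for the
  chosen successor ordinals `αₙ ↗ α`; the copies are kept apart by pairing the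
  first entry of each node with `n`. -/
noncomputable def sTree (c : LimitSequences) (α : Ordinal.{0}) : Set (List ℕ) :=
  Ordinal.limitRecOn α ∅
    (fun _ S => {l | ∃ n : ℕ, l = [n] ∨ ∃ l' ∈ S, l = n :: l'})
    (fun α _ S => {l | ∃ (n : ℕ) (h : c.seq α n < α) (k : ℕ) (l' : List ℕ),
      k :: l' ∈ S (c.seq α n) h ∧ l = Nat.pair n k :: l'})

/-- A tree `T` on `A` is isomorphic to `T(α, s)`: it is isomorphic as a tree and moreover
`(x₁, …, x_{k-1}) ∈ T` whenever `(x₁, …, x_k) ∈ T` and `k ≥ 2`. -/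
def IsIsoSTree {A : Type*} (c : LimitSequences) (α : Ordinal.{0}) (T : Set (List A)) : Prop :=
  TreeIso T (sTree c α) ∧ ∀ (l : List A) (x : A), l ≠ [] → l ++ [x] ∈ T → l ∈ T

/-! ### Weakly null trees and the `ℓ₁⁺`-weakly null index -/

section Banach

variable {X : Type*} [NormedAddCommGroup X] [NormedSpace ℝ X]

/-- A sequence is weakly null if it converges to `0` weakly. -/
def WeaklyNull (y : ℕ → X) : Prop :=
  ∀ f : StrongDual ℝ X, Filter.Tendsto (fun i => f (y i)) Filter.atTop (nhds 0)

/-- A weakly null tree on `X`: a tree isomorphic to `T(α, s)` for some `α < ω₁`, all of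
whose `s`-subsequences are weakly null. -/
def IsWeaklyNullTree (c : LimitSequences) (T : Set (List X)) : Prop :=
  IsTreeOn T ∧ (∃ α < ω₁, IsIsoSTree c α T) ∧ ∀ y : ℕ → X, IsSSubsequence T y → WeaklyNull y

/-- The finite sequence `x` is `K`-basic: the basis projections have norm at most `K`. -/
def IsKBasic (K : ℝ) {m : ℕ} (x : Fin m → X) : Prop :=
  ∀ (a : Fin m → ℝ) (n : ℕ), n ≤ m →
    ‖∑ i : Fin m with i.val < n, a i • x i‖ ≤ K * ‖∑ i : Fin m, a i • x i‖

/-- `x` is an `ℓ₁⁺-K`-sequence: normalized, `K`-basic, with a lower `ℓ₁` estimate with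
constant `1/K` for non-negative coefficients. -/
def IsL1PlusSeq (K : ℝ) {m : ℕ} (x : Fin m → X) : Prop :=
  (∀ i, ‖x i‖ = 1) ∧ IsKBasic K x ∧
    ∀ a : Fin m → ℝ, (∀ i, 0 ≤ a i) → 1 / K * ∑ i, a i ≤ ‖∑ i, a i • x i‖

/-- An `ℓ₁⁺-K`-weakly null tree on `X`. -/
def IsL1PlusWeaklyNullTree (c : LimitSequences) (K : ℝ) (T : Set (List X)) : Prop :=
  IsWeaklyNullTree c T ∧ ∀ l ∈ T, IsL1PlusSeq K l.get

variable (X) in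
/-- The supremum of the orders of the `ℓ₁⁺-K`-weakly null trees on `X`. These orders are at
most `ω₁`; the supremum over no trees is `0`. -/
noncomputable def l1PlusWeaklyNullIndexWith (c : LimitSequences) (K : ℝ) : Ordinal.{0} :=
  sSup {o | ∃ T : Set (List X), IsL1PlusWeaklyNullTree c K T ∧ o = order T}

variable (X) in
/-- The `ℓ₁⁺`-weakly null index `I⁺_w(X)`: the supremum over `K ≥ 1`. -/
noncomputable def l1PlusWeaklyNullIndex (c : LimitSequences) : Ordinal.{0} :=
  ⨆ K : Set.Ici (1 : ℝ), l1PlusWeaklyNullIndexWith X c K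

end Banach

/-! ### Choices of sequences exist -/

theorem exists_succ_seq (α : Ordinal.{0}) (hα : Order.IsSuccLimit α) (h1 : α < ω₁) :
    ∃ u : ℕ → Ordinal.{0}, StrictMono u ∧ (∀ n, ∃ β, u n = β + 1) ∧
      IsLUB (Set.range u) α := by
  have hc : Countable (Set.Iio α) := by
    rw [← Cardinal.mk_le_aleph0_iff, Cardinal.mk_Iio_ordinal, Cardinal.lift_le_aleph0,
      ← Cardinal.lt_aleph_one_iff, ← Cardinal.lt_ord, Cardinal.ord_aleph]
    exact h1
  have hne : Nonempty (Set.Iio α) := ⟨⟨0, hα.bot_lt⟩⟩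
  obtain ⟨e, he⟩ := exists_surjective_nat (Set.Iio α)
  let u : ℕ → Set.Iio α := fun n => Nat.rec ⟨(e 0).1 + 1, hα.add_one_lt (e 0).2⟩
    (fun n a => ⟨max a.1 (e (n + 1)).1 + 1, hα.add_one_lt (max_lt a.2 (e (n + 1)).2)⟩) n
  have hs : ∀ n, (u (n + 1)).1 = max (u n).1 (e (n + 1)).1 + 1 := fun n => rfl
  have h0 : (u 0).1 = (e 0).1 + 1 := rfl
  refine ⟨fun n => (u n).1, strictMono_nat_of_lt_succ fun n => ?_, fun n => ?_, ?_, ?_⟩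
  · rw [hs]; exact (le_max_left _ _).trans_lt (lt_add_one _)
  · cases n with
    | zero => exact ⟨_, h0⟩
    | succ n => exact ⟨_, hs n⟩
  · rintro _ ⟨n, rfl⟩; exact (u n).2.le
  · intro b hb
    by_contra! hlt
    obtain ⟨n, hn⟩ := he ⟨b, hlt⟩
    have h2 : b < (u n).1 := by
      have hbe : b = (e n).1 := by rw [hn]
      cases n with
      | zero => rw [h0, hbe]; exact lt_add_one _
      | succ n => rw [hs, hbe]; exact (le_max_right _ _).trans_lt (lt_add_one _)
    exact absurd (hb ⟨n, rfl⟩) (not_le.2 h2)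

instance : Nonempty LimitSequences := by
  classical
  have h : ∀ α : Ordinal.{0}, ∃ u : ℕ → Ordinal.{0}, Order.IsSuccLimit α → α < ω₁ →
      StrictMono u ∧ (∀ n, ∃ β, u n = β + 1) ∧ IsLUB (Set.range u) α := by
    intro α
    by_cases hα : Order.IsSuccLimit α ∧ α < ω₁
    · obtain ⟨u, hu⟩ := exists_succ_seq α hα.1 hα.2
      exact ⟨u, fun _ _ => hu⟩
    · exact ⟨fun _ => 0, fun h h' => absurd ⟨h, h'⟩ hα⟩
  choose u hu using h
  exact ⟨⟨u, fun α h h' => (hu α h h').1, fun α h h' => (hu α h h').2.1,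
    fun α h h' => (hu α h h').2.2⟩⟩

end WeaklyNullIndex

open scoped Ordinal

namespace WeaklyNullIndex

/-! ### Rank functions and the order of a tree -/

section Rank

variable {A : Type*}

/-! Fix a dense sequence `f` in the dual. On the unit sphere the decreasing sets `weakNhd f N`
detect weak nullity, so for `0 < α < ω₁` an `ℓ₁⁺-K`-weakly null tree of order `α` exists exactly
when the empty list is `α`-extendable in `l1PlusLists X K` along these sets
(`IsL1PlusWeaklyNullTree.extendable`, `Extendable.exists_isL1PlusWeaklyNullTree`). Extendability
does not involve the sequences chosen at limit ordinals.

Countability: suppose that, for one `K`, every countable order occurs. Since `X` is separable, list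
entries can be approximated from a countable dense set, and stabilising over the countably many
approximating lists yields one infinite sequence `s` (`exists_seq_of_extendable`). It inherits a
lower `ℓ₁` estimate on non-negative combinations, so a functional is bounded away from zero on it;
yet `s` stays close to a weakly null sequence (`not_weaklyNull_of_lower_estimate`). Hence the orders
are bounded below `ω₁` for each `K`, and integer values of `K` suffice.

The form `ω ^ α`: an `ℓ₁⁺-K`-sequence followed by another one lying far enough out in the weak
topology is an `ℓ₁⁺-11K`-sequence (`isL1PlusSeq_add`). Grafting a tree onto itself therefore doubles
the order (`Extendable.add`) at the cost of a larger constant, which the supremum over `K` absorbs.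
The index is thus closed under addition, and it is nonzero because `X` is infinite-dimensional. -/

theorem iterDerived_zero (T : Set (List A)) : iterDerived T 0 = T :=
  Ordinal.limitRecOn_zero ..

theorem iterDerived_add_one (T : Set (List A)) (α : Ordinal.{0}) :
    iterDerived T (α + 1) = derived (iterDerived T α) :=
  Ordinal.limitRecOn_add_one ..

theorem iterDerived_limit (T : Set (List A)) {α : Ordinal.{0}} (hα : Order.IsSuccLimit α) :
    iterDerived T α = {x | ∀ β < α, x ∈ iterDerived T β} :=
  Ordinal.limitRecOn_limit _ _ _ _ hα

/-- `T` carries a rank function whose values on `T` are cofinal in `α`, and the values strictly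
above each node `z` are cofinal in the value at `z`. -/
def HasRank (T : Set (List A)) (α : Ordinal.{0}) : Prop :=
  ∃ ρ : T → Ordinal.{0}, (∀ z, ρ z < α) ∧ (∀ β < α, ∃ z, β ≤ ρ z) ∧
    (∀ z w : T, z.1 <+: w.1 → z ≠ w → ρ w < ρ z) ∧
    ∀ z, ∀ β < ρ z, ∃ w : T, z.1 <+: w.1 ∧ z ≠ w ∧ β ≤ ρ w

theorem HasRank.of_treeIso {B : Type*} {T : Set (List A)} {T' : Set (List B)}
    {α : Ordinal.{0}} (h : TreeIso T T') (h' : HasRank T' α) : HasRank T α := by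
  obtain ⟨f, hf⟩ := h
  obtain ⟨ρ, h1, h2, h3, h4⟩ := h'
  refine ⟨ρ ∘ f, fun z => h1 _, fun β hβ => ?_, fun z w hzw hne => ?_, fun z β hβ => ?_⟩
  · obtain ⟨z, hz⟩ := h2 β hβ
    exact ⟨f.symm z, by simpa using hz⟩
  · exact h3 _ _ ((hf _ _).1 hzw) (f.injective.ne hne)
  · obtain ⟨w, hw, hne, hr⟩ := h4 _ β hβ
    refine ⟨f.symm w, (hf _ _).2 (by simpa using hw), ?_, by simpa using hr⟩
    rintro rfl
    simp at hne

/-- Rank drops strictly along the tree order, and the ranks above a node are cofinal in its own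
rank; so deriving the `β`-th derived tree removes precisely the nodes of rank `β`. -/
theorem mem_iterDerived_iff {T : Set (List A)} {ρ : T → Ordinal.{0}}
    (h3 : ∀ z w : T, z.1 <+: w.1 → z ≠ w → ρ w < ρ z)
    (h4 : ∀ z, ∀ β < ρ z, ∃ w : T, z.1 <+: w.1 ∧ z ≠ w ∧ β ≤ ρ w) (β : Ordinal.{0})
    (x : List A) : x ∈ iterDerived T β ↔ ∃ h : x ∈ T, β ≤ ρ ⟨x, h⟩ := by
  induction β using Ordinal.limitRecOn generalizing x with
  | zero => simp [iterDerived_zero]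
  | add_one γ ih =>
    rw [iterDerived_add_one]
    constructor
    · rintro ⟨hx, y, hy, hxy, hne⟩
      obtain ⟨hxT, -⟩ := (ih x).1 hx
      obtain ⟨hyT, hγ⟩ := (ih y).1 hy
      exact ⟨hxT, Order.add_one_le_of_lt
        (hγ.trans_lt (h3 ⟨x, hxT⟩ ⟨y, hyT⟩ hxy (by simpa using hne)))⟩
    · rintro ⟨hxT, hγ⟩
      have hlt : γ < ρ ⟨x, hxT⟩ := Order.add_one_le_iff.1 hγ
      obtain ⟨⟨w, hw⟩, hzw, hne, hr⟩ := h4 _ γ hlt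
      exact ⟨(ih x).2 ⟨hxT, hlt.le⟩, w, (ih w).2 ⟨hw, hr⟩, hzw, by simpa using hne⟩
  | limit α hα ih =>
    rw [iterDerived_limit T hα]
    constructor
    · intro hx
      obtain ⟨hxT, -⟩ := (ih 0 hα.bot_lt x).1 (hx 0 hα.bot_lt)
      refine ⟨hxT, ?_⟩
      rw [hα.le_iff_forall_le]
      intro β hβ
      exact ((ih β hβ x).1 (hx β hβ)).2
    · rintro ⟨hxT, hα'⟩ β hβ
      exact (ih β hβ x).2 ⟨hxT, hβ.le.trans hα'⟩

theorem HasRank.order_eq {T : Set (List A)} {α : Ordinal.{0}} (h : HasRank T α) (hα : α < ω₁) :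
    order T = α := by
  obtain ⟨ρ, h1, h2, h3, h4⟩ := h
  have hmem := mem_iterDerived_iff h3 h4
  have he : iterDerived T α = ∅ := by
    ext x
    simp only [hmem, Set.mem_empty_iff_false, iff_false, not_exists, not_le]
    exact fun h => h1 _
  rw [order, if_pos ⟨α, hα, he⟩]
  refine le_antisymm (csInf_le' he) (le_csInf ⟨α, he⟩ fun β hβ => ?_)
  by_contra! hlt
  obtain ⟨z, hz⟩ := h2 β hlt
  have : z.1 ∈ iterDerived T β := (hmem β z.1).2 ⟨z.2, hz⟩
  rw [hβ] at this
  exact this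

end Rank

/-! ### The recursive structure of `T(α, s)` -/

section STree

variable (c : LimitSequences)

theorem sTree_zero : sTree c 0 = ∅ := Ordinal.limitRecOn_zero ..

theorem sTree_add_one (α : Ordinal.{0}) :
    sTree c (α + 1) = {l | ∃ n : ℕ, l = [n] ∨ ∃ l' ∈ sTree c α, l = n :: l'} :=
  Ordinal.limitRecOn_add_one ..

theorem sTree_limit {α : Ordinal.{0}} (hα : Order.IsSuccLimit α) :
    sTree c α = {l | ∃ (n : ℕ) (_ : c.seq α n < α) (k : ℕ) (l' : List ℕ),
      k :: l' ∈ sTree c (c.seq α n) ∧ l = Nat.pair n k :: l'} :=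
  Ordinal.limitRecOn_limit _ _ _ _ hα

/-- The tree with initial nodes `[m]`, `m ∈ ℕ`, each followed by a copy of `S m`. -/
def stack (S : ℕ → Set (List ℕ)) : Set (List ℕ) :=
  {l | ∃ m l', (l' = [] ∨ l' ∈ S m) ∧ l = m :: l'}

@[simp] theorem nil_notMem_stack (S : ℕ → Set (List ℕ)) : [] ∉ stack S := by
  simp [stack]

@[simp] theorem cons_mem_stack {S : ℕ → Set (List ℕ)} {m : ℕ} {l : List ℕ} :
    m :: l ∈ stack S ↔ l = [] ∨ l ∈ S m := by
  constructor
  · rintro ⟨m', l', h, he⟩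
    obtain ⟨rfl, rfl⟩ := List.cons.inj he
    exact h
  · exact fun h => ⟨m, l, h, rfl⟩

theorem sTree_add_one_eq_stack (α : Ordinal.{0}) :
    sTree c (α + 1) = stack fun _ => sTree c α := by
  rw [sTree_add_one]
  ext l
  constructor
  · rintro ⟨n, rfl | ⟨l', h, rfl⟩⟩ <;> simp [*]
  · rintro ⟨n, l', rfl | h, rfl⟩
    · exact ⟨n, Or.inl rfl⟩
    · exact ⟨n, Or.inr ⟨l', h, rfl⟩⟩

/-- This treats successors and limits alike: at a limit each `αₙ` is some `γₙ + 1`, so its copy is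
already a stack of trees of order `γₙ`, and pairing merges these stacks. Having infinitely many `m`
with `β ≤ δ m` allows finitely many initial nodes to be discarded later. -/
theorem exists_sTree_eq_stack {α : Ordinal.{0}} (h0 : α ≠ 0) (h1 : α < ω₁) :
    ∃ δ : ℕ → Ordinal.{0}, (∀ m, δ m < α) ∧ (∀ β < α, {m | β ≤ δ m}.Infinite) ∧
      sTree c α = stack fun m => sTree c (δ m) := by
  rcases Ordinal.zero_or_succ_or_isSuccLimit α with rfl | ⟨γ, rfl⟩ | hα
  · exact absurd rfl h0
  · refine ⟨fun _ => γ, fun _ => ?_, fun β hβ => ?_, ?_⟩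
    · exact Order.lt_add_one_iff.2 le_rfl
    · have : β ≤ γ := Order.lt_add_one_iff.1 hβ
      simp [this, Set.infinite_univ]
    · exact sTree_add_one_eq_stack c γ
  · choose γ hγ using c.isSucc α hα h1
    have hlt : ∀ n, c.seq α n < α := fun n =>
      (c.strictMono α hα h1 n.lt_succ_self).trans_le ((c.isLUB α hα h1).1 ⟨n + 1, rfl⟩)
    refine ⟨fun m => γ (Nat.unpair m).1, fun m => ?_, fun β hβ => ?_, ?_⟩
    · refine lt_trans ?_ (hlt (Nat.unpair m).1)
      rw [hγ]
      exact lt_add_one _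
    · obtain ⟨_, ⟨n, rfl⟩, hn⟩ := (lt_isLUB_iff (c.isLUB α hα h1)).1 hβ
      rw [hγ] at hn
      refine Set.infinite_of_injective_forall_mem (f := fun k => Nat.pair n k) ?_ fun k => ?_
      · intro k k' h
        exact (Nat.pair_eq_pair.1 h).2
      · simpa using Order.lt_add_one_iff.1 hn
    · rw [sTree_limit c hα]
      ext l
      cases l with
      | nil => simp
      | cons a l =>
        simp only [Set.mem_ofPred_eq, cons_mem_stack, List.cons.injEq]
        constructor
        · rintro ⟨n, -, k, l', h, rfl, rfl⟩
          rw [hγ, sTree_add_one_eq_stack] at h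
          simpa using h
        · intro h
          refine ⟨(Nat.unpair a).1, hlt _, (Nat.unpair a).2, l, ?_, by simp, rfl⟩
          rw [hγ, sTree_add_one_eq_stack]
          simpa using h

theorem induction_sTree {P : Ordinal.{0} → Set (List ℕ) → Prop} (h0 : P 0 ∅)
    (hstack : ∀ (α : Ordinal.{0}) (δ : ℕ → Ordinal.{0}) (S : ℕ → Set (List ℕ)), (∀ m, δ m < α) →
      (∀ β < α, {m | β ≤ δ m}.Infinite) → (∀ m, P (δ m) (S m)) → P α (stack S))
    {α : Ordinal.{0}} (hα : α < ω₁) : P α (sTree c α) := by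
  induction α using WellFoundedLT.induction with
  | ind α ih =>
    rcases eq_or_ne α 0 with rfl | hne
    · rwa [sTree_zero]
    · obtain ⟨δ, hδ, hinf, he⟩ := exists_sTree_eq_stack c hne hα
      rw [he]
      exact hstack α δ _ hδ hinf fun m => ih _ (hδ m) ((hδ m).trans hα)

theorem nil_notMem_sTree {α : Ordinal.{0}} (hα : α < ω₁) : [] ∉ sTree c α :=
  induction_sTree c (P := fun _ S => [] ∉ S) (by simp) (by simp) hα

theorem mem_sTree_of_append {α : Ordinal.{0}} (hα : α < ω₁) {l l' : List ℕ}
    (h : l ++ l' ∈ sTree c α) (hl : l ≠ []) : l ∈ sTree c α := by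
  revert l l'
  refine induction_sTree c
    (P := fun _ S => ∀ {l l' : List ℕ}, l ++ l' ∈ S → l ≠ [] → l ∈ S) (by simp) ?_ hα
  intro α δ S _ _ ih l l' h hl
  cases l with
  | nil => exact absurd rfl hl
  | cons a l =>
    rw [List.cons_append, cons_mem_stack] at h
    rw [cons_mem_stack]
    by_cases h' : l = []
    · exact Or.inl h'
    · exact Or.inr (ih a (h.resolve_left (by simp [h'])) h')

theorem hasRank_sTree {α : Ordinal.{0}} (hα : α < ω₁) : HasRank (sTree c α) α := by
  suffices h : ∃ ρ : List ℕ → Ordinal.{0}, (∀ z ∈ sTree c α, ρ z < α) ∧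
      (∀ β < α, ∃ z ∈ sTree c α, β ≤ ρ z) ∧
      (∀ z ∈ sTree c α, ∀ w ∈ sTree c α, z <+: w → z ≠ w → ρ w < ρ z) ∧
      ∀ z ∈ sTree c α, ∀ β < ρ z, ∃ w ∈ sTree c α, z <+: w ∧ z ≠ w ∧ β ≤ ρ w by
    obtain ⟨ρ, h1, h2, h3, h4⟩ := h
    refine ⟨fun z => ρ z.1, fun z => h1 z.1 z.2, fun β hβ => ?_, fun z w hzw hne => ?_,
      fun z β hβ => ?_⟩
    · obtain ⟨z, hz, hβz⟩ := h2 β hβ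
      exact ⟨⟨z, hz⟩, hβz⟩
    · exact h3 z.1 z.2 w.1 w.2 hzw fun h => hne (Subtype.ext h)
    · obtain ⟨w, hw, hzw, hne, hr⟩ := h4 z.1 z.2 β hβ
      exact ⟨⟨w, hw⟩, hzw, fun h => hne (congrArg Subtype.val h), hr⟩
  refine induction_sTree c (P := fun α S => [] ∉ S ∧ ∃ ρ : List ℕ → Ordinal.{0},
      (∀ z ∈ S, ρ z < α) ∧
      (∀ β < α, ∃ z ∈ S, β ≤ ρ z) ∧ (∀ z ∈ S, ∀ w ∈ S, z <+: w → z ≠ w → ρ w < ρ z) ∧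
      ∀ z ∈ S, ∀ β < ρ z, ∃ w ∈ S, z <+: w ∧ z ≠ w ∧ β ≤ ρ w) ?_ ?_ hα |>.2
  · exact ⟨by simp, fun _ => 0, by simp, by simp, by simp, by simp⟩
  intro α δ S hδ hinf ih
  choose hnil ρ h1 h2 h3 h4 using ih
  -- The node `[m]` receives the order of the tree above it, and longer nodes keep their rank in `S
  -- m`; the value `0` at `[]` is a dummy.
  refine ⟨by simp, fun l => l.rec 0 fun m l' _ => if l' = [] then δ m else ρ m l', ?_, ?_, ?_, ?_⟩
  · rintro _ ⟨m, l, hl, rfl⟩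
    by_cases h : l = []
    · simpa [h] using hδ m
    · simpa [h] using (h1 m l (hl.resolve_left h)).trans (hδ m)
  · intro β hβ
    obtain ⟨m, hm⟩ := (hinf β hβ).nonempty
    exact ⟨[m], by simp, by simpa using hm⟩
  · rintro _ ⟨m, l, hl, rfl⟩ _ ⟨m', l', hl', rfl⟩ hp hne
    rw [List.cons_prefix_cons] at hp
    obtain ⟨rfl, hp⟩ := hp
    have hne' : l ≠ l' := fun h => hne (by rw [h])
    have hl0 : l' ≠ [] := by
      rintro rfl
      exact hne' (List.prefix_nil.1 hp)
    by_cases h : l = []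
    · simpa [h, hl0] using h1 m l' (hl'.resolve_left hl0)
    · simpa [h, hl0] using h3 m l (hl.resolve_left h) l' (hl'.resolve_left hl0) hp hne'
  · rintro _ ⟨m, l, hl, rfl⟩ β hβ
    by_cases h : l = []
    · subst h
      obtain ⟨w, hw, hr⟩ := h2 m β (by simpa using hβ)
      have hw0 : w ≠ [] := fun h => hnil m (h ▸ hw)
      exact ⟨m :: w, by simp [hw], by simp, by simpa using hw0.symm, by simpa [hw0] using hr⟩
    · obtain ⟨w, hw, hp, hne, hr⟩ := h4 m l (hl.resolve_left h) β (by simpa [h] using hβ)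
      have hw0 : w ≠ [] := fun h => hnil m (h ▸ hw)
      exact ⟨m :: w, by simp [hw], by simpa using hp, by simpa using hne, by simpa [hw0] using hr⟩

end STree

theorem IsIsoSTree.order_eq {A : Type*} {c : LimitSequences} {α : Ordinal.{0}}
    {T : Set (List A)} (h : IsIsoSTree c α T) (hα : α < ω₁) : order T = α :=
  ((hasRank_sTree c hα).of_treeIso h.1).order_eq hα


/-! ### Iterated extendability of finite sequences -/

section Extendable

variable {A : Type*}

/-- `l` belongs to `F` and, inductively, for all `β < α` and all `N` there is `y ∈ U N` for which
`l ++ [y]` is `β`-extendable. If the sets `U N` decrease to the empty set then, for `l = []`,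
this says that `F` contains a tree of order `α` whose `s`-subsequences converge along `U`. -/
def Extendable (F : Set (List A)) (U : ℕ → Set A) (α : Ordinal.{0}) (l : List A) : Prop :=
  l ∈ F ∧ ∀ β < α, ∀ N, ∃ y ∈ U N, Extendable F U β (l ++ [y])
termination_by α

variable {F F' : Set (List A)} {U : ℕ → Set A} {α β : Ordinal.{0}} {l : List A}

theorem extendable_iff : Extendable F U α l ↔
    l ∈ F ∧ ∀ β < α, ∀ N, ∃ y ∈ U N, Extendable F U β (l ++ [y]) := by
  rw [Extendable]

theorem Extendable.mem (h : Extendable F U α l) : l ∈ F := (extendable_iff.1 h).1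

theorem Extendable.exists_append (h : Extendable F U α l) (hβ : β < α) (N : ℕ) :
    ∃ y ∈ U N, Extendable F U β (l ++ [y]) := (extendable_iff.1 h).2 β hβ N

theorem Extendable.anti (h : Extendable F U α l) (hβ : β ≤ α) : Extendable F U β l :=
  extendable_iff.2 ⟨h.mem, fun _ hγ N => h.exists_append (hγ.trans_le hβ) N⟩

theorem Extendable.mono (h : Extendable F U α l) (hF : F ⊆ F') : Extendable F' U α l := by
  induction α using WellFoundedLT.induction generalizing l with
  | ind α ih =>
    refine extendable_iff.2 ⟨hF h.mem, fun β hβ N => ?_⟩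
    obtain ⟨y, hy, hy'⟩ := h.exists_append hβ N
    exact ⟨y, hy, ih β hβ hy'⟩

theorem Extendable.append_left {l₁ : List A} {h : ℕ → ℕ} (hU : Antitone U)
    (hF : ∀ l₂ ∈ F, (∀ i (hi : i < l₂.length), l₂[i] ∈ U (h i)) → l₁ ++ l₂ ∈ F')
    (hl : ∀ i (hi : i < l.length), l[i] ∈ U (h i)) (hα : Extendable F U α l) :
    Extendable F' U α (l₁ ++ l) := by
  induction α using WellFoundedLT.induction generalizing l with
  | ind α ih =>
    refine extendable_iff.2 ⟨hF l hα.mem hl, fun β hβ N => ?_⟩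
    -- The new entry must meet both the demand `N` and the smallness `h` required at its position.
    obtain ⟨y, hy, hy'⟩ := hα.exists_append hβ (max N (h l.length))
    refine ⟨y, hU (le_max_left _ _) hy, ?_⟩
    rw [List.append_assoc]
    refine ih β hβ (fun i hi => ?_) hy'
    rw [List.length_append, List.length_singleton] at hi
    rw [List.getElem_append]
    split_ifs with hlt
    · exact hl i hlt
    · obtain rfl : i = l.length := by omega
      simpa using hU (le_max_right _ _) hy

/-- The tree of order `γ` comes first and the tree of order `α` is grafted after its nodes: targets
below `α` use the graft, and a target `α + δ` uses one more step in the first tree. -/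
theorem Extendable.add {γ : Ordinal.{0}} (hU : Antitone U)
    (hF : ∀ l₁ ∈ F, ∃ h : ℕ → ℕ, ∀ l₂ ∈ F,
      (∀ i (hi : i < l₂.length), l₂[i] ∈ U (h i)) → l₁ ++ l₂ ∈ F')
    (hα : Extendable F U α []) (hγ : Extendable F U γ l) : Extendable F' U (α + γ) l := by
  induction γ using WellFoundedLT.induction generalizing l with
  | ind γ ih =>
    obtain ⟨h, hh⟩ := hF l hγ.mem
    have h0 : Extendable F' U α l := by
      simpa using Extendable.append_left hU hh (by simp) hα
    refine extendable_iff.2 ⟨h0.mem, fun β hβ N => ?_⟩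
    rcases lt_or_ge β α with hlt | hge
    · exact h0.exists_append hlt N
    · obtain ⟨δ, rfl⟩ := exists_add_of_le hge
      have hδ : δ < γ := lt_of_add_lt_add_left hβ
      obtain ⟨y, hy, hy'⟩ := hγ.exists_append hδ N
      exact ⟨y, hy, ih δ hδ hy'⟩

/-- If `F` is extendable to every countable order then, after any approximation of `A` by a
countable type `D`, there is an infinite sequence in `D` whose initial segments approximate
members of `F`. -/
theorem exists_seq_of_extendable {D : Type*} [Countable D] {r : A → D → Prop}
    (hr : ∀ N, ∀ y ∈ U N, ∃ d, r y d) (hF : ∀ α < ω₁, Extendable F U α []) :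
    ∃ s : ℕ → D, ∀ n, ∃ l ∈ F, l.length = n ∧
      ∀ i (hi : i < l.length), l[i] ∈ U i ∧ r l[i] (s i) := by
  classical
  let E : Ordinal.{0} → List D → Prop := fun α d => ∃ l : List A, Extendable F U α l ∧
    ∃ hl : l.length = d.length, ∀ i (hi : i < l.length), l[i] ∈ U i ∧ r l[i] (d[i]'(hl ▸ hi))
  have hE : ∀ {α β d}, β ≤ α → E α d → E β d := by
    rintro α β d hle ⟨l, hl, h⟩
    exact ⟨l, hl.anti hle, h⟩
  -- `E` is antitone in the ordinal and there are only countably many lists `d`, so beyond some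
  -- countable `γ` no list is lost. Then `E γ d` gives `E (γ + 1) d`, which leaves room to append an
  -- entry and return to level `γ`, indefinitely.
  obtain ⟨γ, hγ1, hγ⟩ : ∃ γ < ω₁, ∀ d, E γ d → E (γ + 1) d := by
    have : ∀ d, ∃ a < ω₁, ∀ γ, a ≤ γ → E γ d → E (γ + 1) d ∨ ω₁ ≤ γ + 1 := by
      intro d
      by_cases h : ∃ a < ω₁, ¬ E a d
      · obtain ⟨a, ha, hn⟩ := h
        exact ⟨a, ha, fun γ hγ hE' => absurd (hE hγ hE') hn⟩
      · push Not at h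
        exact ⟨0, Ordinal.omega_pos 1, fun γ _ _ => (lt_or_ge (γ + 1) ω₁).imp_left (h _)⟩
    choose a ha h using this
    have hsup : ⨆ d, a d < ω₁ := Ordinal.iSup_lt_omega_one ha
    refine ⟨⨆ d, a d, hsup, fun d hd => (h d _ ?_ hd).resolve_right (not_le.2 ?_)⟩
    · exact Ordinal.le_iSup a d
    · exact (Cardinal.isSuccLimit_omega 1).add_one_lt hsup
  have hstep : ∀ d : {d // E γ d}, ∃ x, E γ (d.1 ++ [x]) := by
    rintro ⟨d, hd⟩
    obtain ⟨l, hl, hlen, h⟩ := hγ d hd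
    obtain ⟨y, hy, hy'⟩ := hl.exists_append (lt_add_one γ) l.length
    obtain ⟨x, hx⟩ := hr _ y hy
    refine ⟨x, l ++ [y], hy', by simp [hlen], fun i hi => ?_⟩
    rw [List.length_append, List.length_singleton] at hi
    simp only [List.getElem_append]
    by_cases hlt : i < l.length
    · have hlt' : i < d.length := hlen ▸ hlt
      simpa [hlt, hlt'] using h i hlt
    · obtain rfl : i = l.length := by omega
      simpa [hlen] using ⟨hlen ▸ hy, hx⟩
  choose g hg using hstep
  have h0 : E γ [] := ⟨[], hF γ hγ1, rfl, by simp⟩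
  let L : ℕ → {d // E γ d} := fun n => n.rec ⟨[], h0⟩ fun _ d => ⟨d.1 ++ [g d], hg d⟩
  have hL : ∀ n, (L n).1 = (List.range n).map fun i => g (L i) := by
    intro n
    induction n with
    | zero => rfl
    | succ n ih =>
      rw [List.range_succ, List.map_append, ← ih]
      rfl
  refine ⟨fun i => g (L i), fun n => ?_⟩
  obtain ⟨l, hl, hlen, h⟩ := (L n).2
  refine ⟨l, hl.mem, by simpa [hL] using hlen, fun i hi => ⟨(h i hi).1, ?_⟩⟩
  simpa [hL] using (h i hi).2

end Extendable

/-! ### Trees labelled by nodes of `T(α, s)` -/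

section Branch

variable {A : Type*}

/-- The list of the labels of the non-empty initial segments of a list. -/
def branch (lab : List ℕ → A) : List ℕ → List A
  | [] => []
  | n :: l => lab [n] :: branch (fun l => lab (n :: l)) l

@[simp] theorem branch_nil (lab : List ℕ → A) : branch lab [] = [] := rfl

theorem branch_cons (lab : List ℕ → A) (n : ℕ) (l : List ℕ) :
    branch lab (n :: l) = lab [n] :: branch (fun l => lab (n :: l)) l := rfl

theorem branch_append (lab : List ℕ → A) (l l' : List ℕ) :
    branch lab (l ++ l') = branch lab l ++ branch (fun t => lab (l ++ t)) l' := by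
  induction l generalizing lab with
  | nil => rfl
  | cons n l ih => simp [branch_cons, ih]

theorem branch_concat (lab : List ℕ → A) (l : List ℕ) (n : ℕ) :
    branch lab (l ++ [n]) = branch lab l ++ [lab (l ++ [n])] := by
  simp [branch_append, branch_cons]

theorem branch_congr {lab lab' : List ℕ → A} (h : ∀ l ≠ [], lab l = lab' l) (l : List ℕ) :
    branch lab l = branch lab' l := by
  induction l generalizing lab lab' with
  | nil => rfl
  | cons n l ih =>
    rw [branch_cons, branch_cons, h _ (List.cons_ne_nil _ _), ih fun t _ => h _ (List.cons_ne_nil _ _)]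

@[simp] theorem length_branch (lab : List ℕ → A) (l : List ℕ) :
    (branch lab l).length = l.length := by
  induction l generalizing lab with
  | nil => rfl
  | cons n l ih => simp [branch_cons, ih]

theorem branch_prefix (lab : List ℕ → A) {l l' : List ℕ} (h : l <+: l') :
    branch lab l <+: branch lab l' := by
  obtain ⟨t, rfl⟩ := h
  exact ⟨_, (branch_append lab l t).symm⟩

/-- Labels may repeat elsewhere in the tree; distinctness among siblings is enough to recover a node
from its branch, one entry at a time. -/
theorem branch_prefix_iff {lab : List ℕ → A} {S : Set (List ℕ)}
    (hS : ∀ l l', l ++ l' ∈ S → l ≠ [] → l ∈ S)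
    (hlab : ∀ z n m, z ++ [n] ∈ S → z ++ [m] ∈ S → lab (z ++ [n]) = lab (z ++ [m]) → n = m)
    {l l' : List ℕ} (hl : l = [] ∨ l ∈ S) (hl' : l' = [] ∨ l' ∈ S) :
    branch lab l <+: branch lab l' ↔ l <+: l' := by
  refine ⟨fun h => ?_, branch_prefix lab⟩
  induction l using List.reverseRecOn with
  | nil => exact List.nil_prefix
  | append_singleton w n ih =>
    have hw : w = [] ∨ w ∈ S := by
      by_cases h0 : w = []
      · exact Or.inl h0
      · exact Or.inr (hS w [n] (hl.resolve_left (by simp)) h0)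
    obtain ⟨t, rfl⟩ := ih hw ((branch_prefix lab ⟨[n], rfl⟩).trans h)
    rw [branch_concat, branch_append, List.prefix_append_right_inj] at h
    cases t with
    | nil => simp at h
    | cons m t =>
      rw [branch_cons, List.cons_prefix_cons] at h
      have hm : w ++ [m] ++ t ∈ S := by simpa using hl'
      obtain rfl := hlab w n m (hl.resolve_left (by simp)) (hS _ t hm (by simp)) h.1
      exact ⟨t, by simp⟩

theorem branch_inj {lab : List ℕ → A} {S : Set (List ℕ)}
    (hS : ∀ l l', l ++ l' ∈ S → l ≠ [] → l ∈ S)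
    (hlab : ∀ z n m, z ++ [n] ∈ S → z ++ [m] ∈ S → lab (z ++ [n]) = lab (z ++ [m]) → n = m)
    {l l' : List ℕ} (hl : l = [] ∨ l ∈ S) (hl' : l' = [] ∨ l' ∈ S)
    (h : branch lab l = branch lab l') : l = l' :=
  ((branch_prefix_iff hS hlab hl hl').1 (h ▸ List.prefix_refl _)).eq_of_length
    (by simpa using congrArg List.length h)

theorem exists_branch_of_isIsoSTree [Nonempty A] {c : LimitSequences} {α : Ordinal.{0}}
    (hα : α < ω₁) {T : Set (List A)} (hT : [] ∉ T) (h : IsIsoSTree c α T) :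
    ∃ lab : List ℕ → A, T = branch lab '' sTree c α ∧ Set.InjOn (branch lab) (sTree c α) := by
  classical
  obtain ⟨⟨f, hf⟩, hclosed⟩ := h
  obtain ⟨a₀⟩ := ‹Nonempty A›
  let e : List ℕ → List A := fun z => if h : z ∈ sTree c α then (f.symm ⟨z, h⟩).1 else []
  have he : ∀ {z} (h : z ∈ sTree c α), e z = (f.symm ⟨z, h⟩).1 := fun h => dif_pos h
  have heT : ∀ {z}, z ∈ sTree c α → e z ∈ T := fun h => he h ▸ (f.symm _).2
  have hpre : ∀ {z w}, z ∈ sTree c α → w ∈ sTree c α → (e z <+: e w ↔ z <+: w) := by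
    intro z w hz hw
    rw [he hz, he hw, hf]
    simp
  have hsurj : ∀ x ∈ T, ∃ z ∈ sTree c α, e z = x := fun x hx =>
    ⟨(f ⟨x, hx⟩).1, (f ⟨x, hx⟩).2, by simp [he (f ⟨x, hx⟩).2]⟩
  have hinj : Set.InjOn e (sTree c α) := by
    intro z hz w hw hzw
    have := (hpre hz hw).1 (hzw ▸ List.prefix_refl _)
    exact this.eq_of_length_le ((hpre hw hz).1 (hzw ▸ List.prefix_refl _)).length_le
  have hnil : e [] = [] := dif_neg (nil_notMem_sTree c hα)
  have hstep : ∀ z n, z ++ [n] ∈ sTree c α → ∃ x, e (z ++ [n]) = e z ++ [x] := by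
    intro z n hz
    have hne : e (z ++ [n]) ≠ [] := fun h => hT (h ▸ heT hz)
    refine ⟨(e (z ++ [n])).getLast hne, ?_⟩
    -- An order isomorphism need not preserve lengths. Closure of `T` under dropping the last entry
    -- makes a non-empty `u` a node strictly below `e (z ++ [n])`, hence at most `e z`, while `e z`
    -- is an initial segment of `u`.
    suffices hu : (e (z ++ [n])).dropLast = e z by
      rw [← hu, List.dropLast_append_getLast]
    set u := (e (z ++ [n])).dropLast with hudef
    have hue : u ++ [(e (z ++ [n])).getLast hne] = e (z ++ [n]) :=
      List.dropLast_append_getLast hne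
    have hup : u <+: e (z ++ [n]) := ⟨_, hue⟩
    have hlt : u.length < (e (z ++ [n])).length := by rw [← hue]; simp
    have hzu : z ≠ [] → z ∈ sTree c α ∧ e z <+: u := by
      intro hz0
      have hzS := mem_sTree_of_append c hα hz hz0
      refine ⟨hzS, ?_⟩
      have h1 : e z <+: e (z ++ [n]) := (hpre hzS hz).2 ⟨_, rfl⟩
      have h2 : e z ≠ e (z ++ [n]) := fun h => by
        simpa using congrArg List.length (hinj hzS hz h)
      rw [← hue] at h1 h2
      exact (List.prefix_concat_iff.1 h1).resolve_left h2
    by_cases hu0 : u = []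
    · by_cases hz0 : z = []
      · rw [hu0, hz0, hnil]
      · obtain ⟨hzS, hzu⟩ := hzu hz0
        rw [hu0, List.prefix_nil] at hzu
        exact absurd (hzu ▸ heT hzS) hT
    · have huT : u ∈ T := hclosed u _ hu0 (hue ▸ heT hz)
      obtain ⟨w, hw, hwu⟩ := hsurj u huT
      have hwz : w <+: z ++ [n] := (hpre hw hz).1 (hwu ▸ hup)
      have hwz' : w <+: z := (List.prefix_concat_iff.1 hwz).resolve_left (by
        rintro rfl
        exact absurd (congrArg List.length hwu) hlt.ne')
      have hz0 : z ≠ [] := by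
        rintro rfl
        rw [List.prefix_nil] at hwz'
        exact nil_notMem_sTree c hα (hwz' ▸ hw)
      obtain ⟨hzS, hzu⟩ := hzu hz0
      have h3 : u <+: e z := hwu ▸ (hpre hw hzS).2 hwz'
      exact h3.eq_of_length_le hzu.length_le
  let lab : List ℕ → A := fun z => (e z).getLastD a₀
  have hbr : ∀ z, z = [] ∨ z ∈ sTree c α → branch lab z = e z := by
    intro z hz
    induction z using List.reverseRecOn with
    | nil => exact hnil.symm
    | append_singleton w n ih =>
      have hwn : w ++ [n] ∈ sTree c α := hz.resolve_left (by simp)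
      have hw : w = [] ∨ w ∈ sTree c α := by
        by_cases h0 : w = []
        · exact Or.inl h0
        · exact Or.inr (mem_sTree_of_append c hα hwn h0)
      obtain ⟨x, hx⟩ := hstep w n hwn
      rw [branch_concat, ih hw, hx]
      simp [lab, hx]
  have hbr' : Set.EqOn (branch lab) e (sTree c α) := fun z hz => hbr z (Or.inr hz)
  refine ⟨lab, ?_, hinj.congr hbr'.symm⟩
  rw [hbr'.image_eq]
  ext x
  exact ⟨fun hx => hsurj x hx, by rintro ⟨z, hz, rfl⟩; exact heT hz⟩

/-- For every `p`, the labels `y` with `p ++ [y] ∈ T` converge along `U`. -/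
def IsNullAlong (U : ℕ → Set A) (T : Set (List A)) : Prop :=
  ∀ p N, {y | p ++ [y] ∈ T ∧ y ∉ U N}.Finite

/-- Only finitely many initial labels miss `U N`, whereas infinitely many carry a subtree of order
at least `β`; some label does both jobs. -/
theorem extendable_of_branch {c : LimitSequences} {α : Ordinal.{0}} (hα : α < ω₁)
    {F : Set (List A)} {U : ℕ → Set A} {lab : List ℕ → A} {p : List A} (hp : p ∈ F)
    (hinj : Set.InjOn (branch lab) (sTree c α)) (hU : IsNullAlong U (branch lab '' sTree c α))
    (hF : ∀ z ∈ sTree c α, p ++ branch lab z ∈ F) : Extendable F U α p := by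
  revert lab p
  refine induction_sTree c (P := fun α S => ∀ {lab : List ℕ → A} {p : List A}, p ∈ F →
    Set.InjOn (branch lab) S → IsNullAlong U (branch lab '' S) →
    (∀ z ∈ S, p ++ branch lab z ∈ F) → Extendable F U α p) ?_ ?_ hα
  · intro lab p hp _ _ _
    exact extendable_iff.2 ⟨hp, fun β hβ => absurd hβ not_lt_zero⟩
  intro α δ S _ hinf ih lab p hp hinj hU hF
  refine extendable_iff.2 ⟨hp, fun β hβ N => ?_⟩
  have hlab : Function.Injective fun m => lab [m] := by
    intro m m' h
    have := hinj (x₁ := [m]) (by simp) (x₂ := [m']) (by simp) (by simpa [branch_cons] using h)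
    simpa using this
  have hfin : {m | lab [m] ∉ U N}.Finite := by
    refine ((hU [] N).preimage hlab.injOn).subset fun m hm => ⟨⟨[m], by simp, rfl⟩, hm⟩
  obtain ⟨m, hβm, hm⟩ := ((hinf β hβ).sdiff hfin).nonempty
  refine ⟨lab [m], not_not.1 hm, ?_⟩
  refine (ih m (lab := fun l => lab (m :: l)) ?_ ?_ ?_ ?_).anti hβm
  · exact hF [m] (by simp)
  · intro z hz w hw h
    have := hinj (x₁ := m :: z) (by simp [hz]) (x₂ := m :: w) (by simp [hw])
      (by simpa [branch_cons] using h)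
    simpa using this
  · intro q N
    refine (hU (lab [m] :: q) N).subset ?_
    rintro y ⟨⟨z, hz, hzy⟩, hy⟩
    exact ⟨⟨m :: z, by simp [hz], by simp [branch_cons, hzy]⟩, hy⟩
  · intro z hz
    simpa [branch_cons] using hF (m :: z) (by simp [hz])

/-- Siblings need distinct labels. Every point eventually leaves `U`, so going far enough out avoids
the finitely many labels already used. -/
theorem exists_injective_seq {U : ℕ → Set A} (hU : Antitone U) (hU0 : ∀ y, ∃ N, y ∉ U N)
    {Q : ℕ → A → Prop} (hQ : ∀ m N, ∃ y ∈ U N, Q m y) :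
    ∃ y : ℕ → A, Function.Injective y ∧ ∀ m, y m ∈ U m ∧ Q m (y m) := by
  classical
  have h : ∀ (s : Finset A) (m : ℕ), ∃ y, y ∉ s ∧ y ∈ U m ∧ Q m y := by
    intro s m
    choose N hN using hU0
    obtain ⟨y, hy, hq⟩ := hQ m (max m (s.sup N))
    exact ⟨y, fun hs => hN y (hU ((Finset.le_sup hs).trans (le_max_right _ _)) hy),
      hU (le_max_left _ _) hy, hq⟩
  choose g hg1 hg2 using h
  let s : ℕ → Finset A := fun n => n.rec ∅ fun n s => insert (g s n) s
  have hs : ∀ n, s (n + 1) = insert (g (s n) n) (s n) := fun n => rfl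
  have hmono : Monotone s := monotone_nat_of_le_succ fun n => by
    rw [hs]
    exact Finset.subset_insert _ _
  refine ⟨fun n => g (s n) n, Function.Injective.of_lt_imp_ne fun m n hmn h =>
    hg1 (s n) n ?_, fun m => hg2 _ _⟩
  rw [← h]
  exact hmono (Nat.succ_le_of_lt hmn) (hs m ▸ Finset.mem_insert_self _ _)

theorem Extendable.exists_lab [Nonempty A] (c : LimitSequences) {α : Ordinal.{0}} (hα : α < ω₁)
    {F : Set (List A)} {U : ℕ → Set A} (hU : Antitone U) (hU0 : ∀ y, ∃ N, y ∉ U N)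
    {p : List A} (h : Extendable F U α p) :
    ∃ lab : List ℕ → A, (∀ z ∈ sTree c α, p ++ branch lab z ∈ F) ∧
      (∀ z n, z ++ [n] ∈ sTree c α → lab (z ++ [n]) ∈ U n) ∧
      ∀ z n m, z ++ [n] ∈ sTree c α → z ++ [m] ∈ sTree c α →
        lab (z ++ [n]) = lab (z ++ [m]) → n = m := by
  revert p
  refine induction_sTree c (P := fun α S => ∀ {p : List A}, Extendable F U α p →
    ∃ lab : List ℕ → A, (∀ z ∈ S, p ++ branch lab z ∈ F) ∧
      (∀ z n, z ++ [n] ∈ S → lab (z ++ [n]) ∈ U n) ∧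
      ∀ z n m, z ++ [n] ∈ S → z ++ [m] ∈ S →
        lab (z ++ [n]) = lab (z ++ [m]) → n = m) ?_ ?_ hα
  · intro p h
    exact ⟨fun _ => Classical.arbitrary A, by simp⟩
  intro α δ S hδ _ ih p h
  obtain ⟨y, hinj, hy⟩ := exists_injective_seq hU hU0
    (Q := fun m y => Extendable F U (δ m) (p ++ [y])) fun m N => h.exists_append (hδ m) N
  choose lab h1 h2 h3 using fun m => ih m (hy m).2
  let lab' : List ℕ → A
    | [] => y 0
    | [m] => y m
    | m :: n :: l => lab m (n :: l)
  have hlab' : ∀ m z n, lab' (m :: (z ++ [n])) = lab m (z ++ [n]) := by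
    rintro m (_ | ⟨k, z⟩) n <;> rfl
  refine ⟨lab', ?_, ?_, ?_⟩
  · rintro _ ⟨m, l, hl, rfl⟩
    have hbr : branch (fun t => lab' (m :: t)) l = branch (lab m) l := by
      refine branch_congr ?_ l
      rintro (_ | ⟨k, t⟩) ht
      · exact absurd rfl ht
      · rfl
    rw [branch_cons, hbr]
    rcases hl with rfl | hl
    · exact (hy m).2.mem
    · simpa using h1 m l hl
  · rintro (_ | ⟨m, z⟩) n hz
    · exact (hy n).1
    · rw [List.cons_append, hlab']
      exact h2 m z n (by simpa using hz)
  · rintro (_ | ⟨k, z⟩) n m hn hm he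
    · exact hinj he
    · rw [List.cons_append, List.cons_append, hlab', hlab'] at he
      exact h3 k z n m (by simpa using hn) (by simpa using hm) he

theorem Extendable.exists_isIsoSTree [Nonempty A] (c : LimitSequences) {α : Ordinal.{0}}
    (h0 : α ≠ 0) (hα : α < ω₁) {F : Set (List A)} {U : ℕ → Set A} (hU : Antitone U)
    (hU0 : ∀ y, ∃ N, y ∉ U N) (h : Extendable F U α []) :
    ∃ T : Set (List A), IsTreeOn T ∧ IsIsoSTree c α T ∧ IsNullAlong U T ∧ T ⊆ F := by
  obtain ⟨lab, h1, h2, h3⟩ := h.exists_lab c hα hU hU0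
  have hS : ∀ l l', l ++ l' ∈ sTree c α → l ≠ [] → l ∈ sTree c α :=
    fun l l' => mem_sTree_of_append c hα
  have hnil := nil_notMem_sTree c hα
  have hinj : Set.InjOn (branch lab) (sTree c α) := fun x hx y hy hxy =>
    branch_inj hS h3 (Or.inr hx) (Or.inr hy) hxy
  have hconcat : ∀ {p y}, p ++ [y] ∈ branch lab '' sTree c α →
      ∃ w n, w ++ [n] ∈ sTree c α ∧ branch lab w = p ∧ lab (w ++ [n]) = y := by
    rintro p y ⟨z, hz, hzy⟩
    obtain rfl | ⟨w, n, rfl⟩ := List.eq_nil_or_concat z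
    · exact absurd hz hnil
    · rw [List.concat_eq_append] at hz hzy
      rw [branch_concat] at hzy
      obtain ⟨h4, h5⟩ := List.append_inj' hzy rfl
      exact ⟨w, n, hz, h4, by simpa using h5⟩
  refine ⟨branch lab '' sTree c α, ⟨?_, ?_⟩, ⟨?_, ?_⟩, ?_, ?_⟩
  · obtain ⟨δ, -, -, he⟩ := exists_sTree_eq_stack c h0 hα
    exact ⟨_, [0], by simp [he], rfl⟩
  · rintro ⟨z, hz, hz0⟩
    have : z = [] := by simpa using congrArg List.length hz0
    exact hnil (this ▸ hz)
  · let f := Equiv.Set.imageOfInjOn _ _ hinj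
    refine ⟨f.symm, fun x y => ?_⟩
    obtain ⟨x, rfl⟩ := f.surjective x
    obtain ⟨y, rfl⟩ := f.surjective y
    rw [Equiv.symm_apply_apply, Equiv.symm_apply_apply]
    exact branch_prefix_iff hS h3 (Or.inr x.2) (Or.inr y.2)
  · intro l x hl hlx
    obtain ⟨w, n, hw, rfl, -⟩ := hconcat hlx
    exact ⟨w, hS w _ hw (by rintro rfl; exact hl rfl), rfl⟩
  · intro p N
    rcases Set.eq_empty_or_nonempty {y | p ++ [y] ∈ branch lab '' sTree c α ∧ y ∉ U N} with
      he | ⟨y₀, hy₀, -⟩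
    · rw [he]
      exact Set.finite_empty
    obtain ⟨w₀, n₀, hw₀, hp, -⟩ := hconcat hy₀
    have hmem : ∀ {w n}, w ++ [n] ∈ sTree c α → w = [] ∨ w ∈ sTree c α := fun hw =>
      or_iff_not_imp_left.2 (hS _ _ hw)
    refine ((Set.finite_Iio N).image fun n => lab (w₀ ++ [n])).subset ?_
    rintro y ⟨hy, hyN⟩
    obtain ⟨w, n, hw, hp', rfl⟩ := hconcat hy
    obtain rfl := branch_inj hS h3 (hmem hw) (hmem hw₀) (hp'.trans hp.symm)
    refine ⟨n, not_le.1 fun hle => hyN (hU hle (h2 w n hw)), rfl⟩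
  · rintro _ ⟨z, hz, rfl⟩
    simpa using h1 z hz

theorem IsIsoSTree.extendable [Nonempty A] {c : LimitSequences} {α : Ordinal.{0}} (hα : α < ω₁)
    {F : Set (List A)} {U : ℕ → Set A} {T : Set (List A)} (hT : [] ∉ T) (h : IsIsoSTree c α T)
    (hU : IsNullAlong U T) (hTF : T ⊆ F) (hF : [] ∈ F) : Extendable F U α [] := by
  obtain ⟨lab, rfl, hinj⟩ := exists_branch_of_isIsoSTree hα hT h
  exact extendable_of_branch hα hF hinj hU fun z hz => hTF ⟨z, hz, rfl⟩

end Branch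


variable {X : Type*} [NormedAddCommGroup X] [NormedSpace ℝ X]

/-! ### Weak neighbourhoods of zero in the unit sphere -/

section WeakNhd

/-- The unit vectors on which the functionals `f 0, …, f N` are smaller than `1 / (N + 1)`. -/
def weakNhd (f : ℕ → StrongDual ℝ X) (N : ℕ) : Set X :=
  {y | ‖y‖ = 1 ∧ ∀ j ≤ N, |f j y| < 1 / ((N : ℝ) + 1)}

variable {f : ℕ → StrongDual ℝ X}

theorem antitone_weakNhd (f : ℕ → StrongDual ℝ X) : Antitone (weakNhd f) := by
  intro M N h y hy
  refine ⟨hy.1, fun j hj => (hy.2 j (hj.trans h)).trans_le ?_⟩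
  gcongr

theorem weaklyNull_of_eventually (hf : DenseRange f) {y : ℕ → X}
    (hy : ∀ N, ∀ᶠ i in Filter.atTop, y i ∈ weakNhd f N) : WeaklyNull y := by
  intro g
  rw [Metric.tendsto_atTop']
  intro ε hε
  obtain ⟨j, hj⟩ := hf.exists_dist_lt g (half_pos hε)
  obtain ⟨N, hN⟩ := exists_nat_one_div_lt (half_pos hε)
  obtain ⟨M, hM⟩ := Filter.eventually_atTop.1 (hy (max j N))
  refine ⟨M, fun i hi => ?_⟩
  obtain ⟨h1, h2⟩ := hM i hi.le
  have h3 : |f j (y i)| < ε / 2 := by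
    refine (h2 j (le_max_left _ _)).trans_le (le_trans ?_ hN.le)
    gcongr
    exact le_max_right _ _
  have h4 : |(g - f j) (y i)| ≤ ‖g - f j‖ := by simpa [h1] using (g - f j).le_opNorm (y i)
  rw [dist_eq_norm] at hj
  rw [dist_zero_right, Real.norm_eq_abs]
  have h5 : g (y i) = (g - f j) (y i) + f j (y i) := by simp
  rw [h5]
  exact (abs_add_le _ _).trans_lt (by linarith)

theorem WeaklyNull.eventually_mem {y : ℕ → X} (hy : WeaklyNull y) (h1 : ∀ i, ‖y i‖ = 1) (N : ℕ) :
    ∀ᶠ i in Filter.atTop, y i ∈ weakNhd f N := by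
  have h : ∀ j ∈ Finset.range (N + 1), ∀ᶠ i in Filter.atTop, |f j (y i)| < 1 / ((N : ℝ) + 1) := by
    intro j _
    have := (hy (f j)).abs
    rw [abs_zero] at this
    exact this.eventually_lt_const (by positivity)
  filter_upwards [(Filter.eventually_all_finset _).2 h] with i hi
  exact ⟨h1 i, fun j hj => hi j (by simpa [Nat.lt_succ_iff] using hj)⟩

theorem exists_notMem_weakNhd (hf : DenseRange f) (y : X) : ∃ N, y ∉ weakNhd f N := by
  by_contra! h
  have h0 : WeaklyNull fun _ : ℕ => y :=
    weaklyNull_of_eventually hf fun N => Filter.Eventually.of_forall fun _ => h N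
  have hne : y ≠ 0 := by
    rintro rfl
    simpa using (h 0).1
  obtain ⟨g, -, hg⟩ := exists_dual_vector ℝ y (norm_ne_zero_iff.2 hne)
  have := tendsto_nhds_unique (h0 g) tendsto_const_nhds
  rw [hg, (h 0).1] at this
  norm_num at this

theorem weakNhd_nonempty (hinf : ¬ FiniteDimensional ℝ X) (f : ℕ → StrongDual ℝ X) (N : ℕ) :
    (weakNhd f N).Nonempty := by
  let L : X →ₗ[ℝ] (Fin (N + 1) → ℝ) := LinearMap.pi fun j => (f j : X →ₗ[ℝ] ℝ)
  have hL : ¬ Function.Injective L := fun h => hinf (FiniteDimensional.of_injective L h)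
  rw [← LinearMap.ker_eq_bot, Submodule.eq_bot_iff] at hL
  push Not at hL
  obtain ⟨x, hx, hne⟩ := hL
  refine ⟨‖x‖⁻¹ • x, norm_smul_inv_norm (𝕜 := ℝ) hne, fun j hj => ?_⟩
  have : f j x = 0 := congrFun hx ⟨j, Nat.lt_succ_of_le hj⟩
  rw [map_smul, this, smul_zero, abs_zero]
  positivity

/-- A Banach space with separable dual is separable. -/
theorem separableSpace_of_strongDual [TopologicalSpace.SeparableSpace (StrongDual ℝ X)] :
    TopologicalSpace.SeparableSpace X := by
  let f := TopologicalSpace.denseSeq (StrongDual ℝ X)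
  have hx : ∀ j, ∃ x : X, ‖x‖ ≤ 1 ∧ ‖f j‖ / 2 ≤ |f j x| := by
    intro j
    rcases eq_or_ne (f j) 0 with h0 | h0
    · exact ⟨0, by simp, by simp [h0]⟩
    · obtain ⟨x, hx, hlt⟩ := (f j).exists_lt_apply_of_lt_opNorm (half_lt_self (norm_pos_iff.2 h0))
      exact ⟨x, hx.le, hlt.le⟩
  choose x hx1 hx2 using hx
  have hsep : TopologicalSpace.IsSeparable (Submodule.span ℝ (Set.range x) : Set X) :=
    (Set.countable_range x).isSeparable.span
  have htop : (Submodule.span ℝ (Set.range x)).topologicalClosure = ⊤ := by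
    by_contra hne
    obtain ⟨y, -, hy⟩ := SetLike.exists_of_lt (lt_top_iff_ne_top.2 hne)
    obtain ⟨g, u, hg, hu⟩ := geometric_hahn_banach_closed_point
      (Submodule.span ℝ (Set.range x)).topologicalClosure.convex
      (Submodule.isClosed_topologicalClosure _) hy
    have hzero : ∀ z ∈ (Submodule.span ℝ (Set.range x)).topologicalClosure, g z = 0 := by
      intro z hz
      by_contra hgz
      have := hg ((u / g z) • z) (Submodule.smul_mem _ _ hz)
      rw [map_smul, smul_eq_mul, div_mul_cancel₀ _ hgz] at this
      exact lt_irrefl _ this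
    have hg0 : g ≠ 0 := by
      rintro rfl
      have := hg 0 (Submodule.zero_mem _)
      simp at this hu
      linarith
    -- As `g` vanishes at `x j`, `‖f j‖ / 2 ≤ ‖g - f j‖ < ‖g‖ / 4`, whence `‖g‖ < 3 / 4 * ‖g‖`.
    obtain ⟨j, hj⟩ := (TopologicalSpace.denseRange_denseSeq (StrongDual ℝ X)).exists_dist_lt g
      (ε := ‖g‖ / 4) (by positivity)
    rw [dist_eq_norm] at hj
    change ‖g - f j‖ < _ at hj
    have hgx : g (x j) = 0 := hzero _
      (Submodule.le_topologicalClosure _ (Submodule.subset_span ⟨j, rfl⟩))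
    have h1 : |f j (x j)| ≤ ‖g - f j‖ := by
      have := (g - f j).le_of_opNorm_le_of_le le_rfl (hx1 j)
      simpa [hgx] using this
    have h2 := hx2 j
    have h3 : ‖g‖ ≤ ‖g - f j‖ + ‖f j‖ := by
      simpa using norm_add_le (g - f j) (f j)
    have h4 : 0 < ‖g‖ := norm_pos_iff.2 hg0
    linarith
  have := hsep.closure
  rw [← Submodule.topologicalClosure_coe, htop, Submodule.top_coe] at this
  exact TopologicalSpace.isSeparable_univ_iff.1 this

/-- If infinitely many one-entry extensions of `p` violated `weakNhd f N`, all such extensions would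
form a countably infinite `s`-node. Enumerated, it is weakly null, so only finitely many of its
entries can violate it. -/
theorem isNullAlong_of_weaklyNull {c : LimitSequences} {α : Ordinal.{0}}
    {T : Set (List X)} (hT : IsIsoSTree c α T) (h1 : ∀ l ∈ T, ∀ x ∈ l, ‖x‖ = 1)
    (hnil : [] ∉ T) (hw : ∀ y : ℕ → X, IsSSubsequence T y → WeaklyNull y) :
    IsNullAlong (weakNhd f) T := by
  intro p N
  by_contra hfin
  let C : Set X := {y | p ++ [y] ∈ T}
  have hinf : C.Infinite := Set.Infinite.mono (fun y hy => hy.1) hfin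
  have hcount : T.Countable := by
    obtain ⟨g, -⟩ := hT.1
    have : Countable T := g.injective.countable
    exact Set.countable_coe_iff.1 this
  have hC : C.Countable := hcount.preimage_of_injOn (f := fun y => p ++ [y])
    (fun y _ z _ h => by simpa using h)
  have : Countable C := hC.to_subtype
  have : Infinite C := hinf.to_subtype
  obtain ⟨e⟩ := nonempty_equiv_of_countable (α := ℕ) (β := C)
  have hbij : Set.BijOn (fun i => p ++ [(e i : X)]) Set.univ {l | ∃ y ∈ C, l = p ++ [y]} := by
    refine ⟨fun i _ => ⟨e i, (e i).2, rfl⟩, fun i _ j _ h => ?_, ?_⟩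
    · exact e.injective (Subtype.ext (by simpa using h))
    · rintro _ ⟨y, hy, rfl⟩
      exact ⟨e.symm ⟨y, hy⟩, trivial, by simp⟩
  have hs : IsSNode T {l | ∃ y ∈ C, l = p ++ [y]} := by
    obtain ⟨y₀, hy₀⟩ := hinf.nonempty
    by_cases hp : p = []
    · left
      subst hp
      ext l
      constructor
      · rintro ⟨y, hy, rfl⟩
        refine ⟨hy, fun z hz hzy => ?_⟩
        rw [List.nil_append, ← List.nil_append [y], List.prefix_concat_iff, List.prefix_nil] at hzy
        exact hzy.resolve_right fun h => hnil (h ▸ hz)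
      · rintro ⟨hl, hmin⟩
        obtain rfl | ⟨w, y, rfl⟩ := List.eq_nil_or_concat l
        · exact absurd hl hnil
        rw [List.concat_eq_append] at hl hmin ⊢
        by_cases hw0 : w = []
        · subst hw0
          exact ⟨y, hl, rfl⟩
        · have := hmin w (hT.2 w y hw0 hl) ⟨_, rfl⟩
          simp at this
    · right
      have hpT : p ∈ T := hT.2 p y₀ hp hy₀
      refine ⟨p, ⟨hpT, _, hy₀, ⟨_, rfl⟩, by simp⟩, ?_⟩
      ext l
      constructor
      · rintro ⟨y, hy, rfl⟩
        refine ⟨hpT, hy, ⟨_, rfl⟩, by simp, fun z _ hpz hzy => ?_⟩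
        rw [List.prefix_concat_iff] at hzy
        exact hzy.symm.imp_left fun h => (hpz.eq_of_length_le h.length_le).symm
      · rintro ⟨-, hl, ⟨t, rfl⟩, hne, hmin⟩
        obtain rfl | ⟨w, y, rfl⟩ := List.eq_nil_or_concat t
        · simp at hne
        rw [List.concat_eq_append, ← List.append_assoc] at hl hmin ⊢
        rcases hmin (p ++ w) (hT.2 _ y (by simp [hp]) hl) ⟨_, rfl⟩ ⟨_, rfl⟩ with h | h
        · have : w = [] := by simpa using h
          subst this
          exact ⟨y, by simpa [C] using hl, by simp⟩
        · simp at h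
  have hev := (hw _ ⟨_, p, hs, hbij⟩).eventually_mem (f := f)
    (fun i => h1 _ (e i).2 _ (by simp)) N
  obtain ⟨M, hM⟩ := Filter.eventually_atTop.1 hev
  refine hfin (((Set.finite_Iio M).image fun i => (e i : X)).subset ?_)
  rintro y ⟨hy, hyN⟩
  refine ⟨e.symm ⟨y, hy⟩, Set.mem_Iio.2 (not_le.1 fun h => hyN ?_), by simp⟩
  simpa using hM (e.symm ⟨y, hy⟩) h

theorem IsNullAlong.weaklyNull (hf : DenseRange f) {T : Set (List X)}
    (h : IsNullAlong (weakNhd f) T) {y : ℕ → X} (hy : IsSSubsequence T y) : WeaklyNull y := by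
  obtain ⟨S, p, hS, hbij⟩ := hy
  have hST : S ⊆ T := by
    rcases hS with rfl | ⟨z, -, rfl⟩
    · exact fun w hw => hw.1
    · exact fun w hw => hw.2.1
  have hinj : Function.Injective y := fun i j hij =>
    hbij.injOn (Set.mem_univ i) (Set.mem_univ j) (by simp [hij])
  refine weaklyNull_of_eventually hf fun N => ?_
  have hfin : {i | ¬ y i ∈ weakNhd f N}.Finite :=
    ((h p N).preimage hinj.injOn).subset fun i hi => ⟨hST (hbij.mapsTo (Set.mem_univ i)), hi⟩
  rw [← Nat.cofinite_eq_atTop]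
  exact hfin

end WeakNhd


/-! ### `ℓ₁⁺`-sequences indexed by natural numbers -/

section L1Plus

theorem sum_filter_val_lt {M : Type*} [AddCommMonoid M] {m n : ℕ} (h : n ≤ m) (g : ℕ → M) :
    ∑ i : Fin m with i.val < n, g i = ∑ i ∈ Finset.range n, g i := by
  rw [Finset.sum_filter, ← Finset.sum_range fun i => if i < n then g i else 0,
    ← Finset.sum_filter]
  congr 1
  ext i
  simp only [Finset.mem_filter, Finset.mem_range]
  omega

theorem isL1PlusSeq_iff {K : ℝ} {m : ℕ} {x : ℕ → X} :
    IsL1PlusSeq K (fun i : Fin m => x i) ↔ (∀ i < m, ‖x i‖ = 1) ∧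
      (∀ a : ℕ → ℝ, ∀ n ≤ m, ‖∑ i ∈ Finset.range n, a i • x i‖ ≤
        K * ‖∑ i ∈ Finset.range m, a i • x i‖) ∧
      ∀ a : ℕ → ℝ, (∀ i, 0 ≤ a i) →
        1 / K * ∑ i ∈ Finset.range m, a i ≤ ‖∑ i ∈ Finset.range m, a i • x i‖ := by
  have hext : ∀ a : Fin m → ℝ, ∃ b : ℕ → ℝ, (∀ i : Fin m, a i = b i) ∧
      ((∀ i, 0 ≤ a i) → ∀ i, 0 ≤ b i) := by
    intro a
    refine ⟨fun i => if h : i < m then a ⟨i, h⟩ else 0, fun i => by simp, fun h i => ?_⟩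
    dsimp only
    split_ifs
    exacts [h _, le_rfl]
  refine and_congr ⟨fun h i hi => h ⟨i, hi⟩, fun h i => h i i.2⟩ (and_congr ?_ ?_)
  · constructor
    · intro h a n hn
      have := h (fun i => a i) n hn
      rwa [sum_filter_val_lt hn fun i => a i • x i,
        ← Finset.sum_range fun i => a i • x i] at this
    · intro h a n hn
      obtain ⟨b, hb, -⟩ := hext a
      simp only [hb]
      rw [sum_filter_val_lt hn fun i => b i • x i, ← Finset.sum_range fun i => b i • x i]
      exact h b n hn
  · constructor
    · intro h a ha
      have := h (fun i => a i) fun i => ha i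
      rwa [← Finset.sum_range a, ← Finset.sum_range fun i => a i • x i] at this
    · intro h a ha
      obtain ⟨b, hb, hb0⟩ := hext a
      simp only [hb]
      rw [← Finset.sum_range b, ← Finset.sum_range fun i => b i • x i]
      exact h b (hb0 ha)

variable (X) in
/-- The finite lists in `X` that are `ℓ₁⁺-K`-sequences. -/
def l1PlusLists (K : ℝ) : Set (List X) := {l | IsL1PlusSeq K l.get}

theorem mem_l1PlusLists_iff {K : ℝ} {l : List X} {x : ℕ → X}
    (hx : ∀ i (hi : i < l.length), l[i] = x i) :
    l ∈ l1PlusLists X K ↔ IsL1PlusSeq K (fun i : Fin l.length => x i) := by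
  have : l.get = fun i : Fin l.length => x i := funext fun i => by simp [← hx i i.2]
  rw [← this]
  rfl

theorem nil_mem_l1PlusLists (K : ℝ) : [] ∈ l1PlusLists X K := by
  refine ⟨fun i => i.elim0, fun a n _ => ?_, fun a _ => ?_⟩ <;> simp

theorem l1PlusLists_mono {K L : ℝ} (hK : 0 < K) (h : K ≤ L) :
    l1PlusLists X K ⊆ l1PlusLists X L := by
  rintro l ⟨h1, h2, h3⟩
  refine ⟨h1, fun a n hn => (h2 a n hn).trans (by gcongr), fun a ha => le_trans ?_ (h3 a ha)⟩
  gcongr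
  exact Finset.sum_nonneg fun i _ => ha i

theorem singleton_mem_l1PlusLists {y : X} (hy : ‖y‖ = 1) : [y] ∈ l1PlusLists X 1 := by
  rw [mem_l1PlusLists_iff (x := fun _ => y) (by simp), isL1PlusSeq_iff (x := fun _ => y)]
  refine ⟨fun _ _ => hy, fun a n hn => ?_, fun a ha => ?_⟩
  · rw [List.length_singleton] at hn ⊢
    interval_cases n <;> simp
  · simp [norm_smul, hy, abs_of_nonneg (ha 0)]

/-- On a finite-dimensional subspace, finitely many functionals of a dense sequence are almost
norming. -/
theorem exists_norming {f : ℕ → StrongDual ℝ X} (hf : DenseRange f) (E : Submodule ℝ X)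
    [FiniteDimensional ℝ E] :
    ∃ N, ∀ u ∈ E, u ≠ 0 → ∃ j ≤ N, ‖f j‖ ≤ 2 ∧ 3 / 4 * ‖u‖ ≤ f j u := by
  have : ProperSpace E := FiniteDimensional.proper_real E
  have hopen : ∀ j, IsOpen {u : E | ‖f j‖ ≤ 2 ∧ 3 / 4 < f j u} := fun j =>
    isOpen_const.inter (isOpen_lt continuous_const ((f j).continuous.comp continuous_subtype_val))
  have hcover : Metric.sphere (0 : E) 1 ⊆ ⋃ j, {u : E | ‖f j‖ ≤ 2 ∧ 3 / 4 < f j u} := by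
    intro u hu
    have hu1 : ‖(u : X)‖ = 1 := by simpa using hu
    obtain ⟨g, hg, hgu⟩ := exists_dual_vector ℝ (u : X) (by simp [hu1])
    -- Since `‖g‖ ≤ 1` and `g u = 1`, an error below `1 / 4` leaves `‖f j‖ ≤ 2` and `f j u > 3 / 4`.
    obtain ⟨j, hj⟩ := hf.exists_dist_lt g (ε := 1 / 4) (by norm_num)
    rw [dist_eq_norm] at hj
    have hgu1 : g u = 1 := by rw [hgu, hu1]; norm_num
    have h1 : |(g - f j) u| ≤ ‖g - f j‖ := by simpa [hu1] using (g - f j).le_opNorm (u : X)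
    have h2 : ‖f j‖ ≤ ‖g‖ + ‖g - f j‖ := by
      simpa [sub_sub_cancel] using norm_sub_le g (g - f j)
    refine Set.mem_iUnion.2 ⟨j, by linarith, ?_⟩
    have h3 := (abs_le.1 h1).2
    rw [sub_apply, hgu1] at h3
    linarith
  obtain ⟨t, ht⟩ := (isCompact_sphere (0 : E) 1).elim_finite_subcover _ hopen hcover
  refine ⟨t.sup id, fun u hu hne => ?_⟩
  have hpos : 0 < ‖u‖ := norm_pos_iff.2 hne
  have hmem : ‖u‖⁻¹ • (⟨u, hu⟩ : E) ∈ Metric.sphere (0 : E) 1 := by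
    simpa [norm_smul] using inv_mul_cancel₀ hpos.ne'
  obtain ⟨j, hj, hj2, hju⟩ := Set.mem_iUnion₂.1 (ht hmem)
  refine ⟨j, Finset.le_sup (f := id) hj, hj2, ?_⟩
  have h : f j (‖u‖⁻¹ • u) = ‖u‖⁻¹ * f j u := by simp
  change 3 / 4 < f j (‖u‖⁻¹ • u) at hju
  rw [h, inv_mul_eq_div, lt_div_iff₀ hpos] at hju
  exact hju.le

/-- Let `u` and `v` be the two blocks of a combination. Some `f j` almost norms `u` and is at most
`‖v‖ / 4` on `v`, so `3/4 ‖u‖ ≤ 2 ‖u + v‖ + 1/4 ‖v‖`. With `‖v‖ ≤ ‖u + v‖ + ‖u‖` this gives `‖u‖ ≤ 5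
‖u + v‖` and `‖v‖ ≤ 6 ‖u + v‖`; the constant is `11 = 5 + 6`. -/
theorem isL1PlusSeq_add {f : ℕ → StrongDual ℝ X} {K : ℝ} (hK : 1 ≤ K) {m n N : ℕ}
    {z : ℕ → X} {δ : ℕ → ℝ} (hx : IsL1PlusSeq K (fun i : Fin m => z i))
    (hy : IsL1PlusSeq K (fun i : Fin n => z (m + i)))
    (hN : ∀ u ∈ Submodule.span ℝ (z '' Set.Iio m), u ≠ 0 →
      ∃ j ≤ N, ‖f j‖ ≤ 2 ∧ 3 / 4 * ‖u‖ ≤ f j u)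
    (hδ : ∀ j ≤ N, ∀ i < n, |f j (z (m + i))| ≤ δ i)
    (hsum : 2 * K * ∑ i ∈ Finset.range n, δ i ≤ 1 / 4) :
    IsL1PlusSeq (11 * K) (fun i : Fin (m + n) => z i) := by
  rw [isL1PlusSeq_iff] at hx ⊢
  rw [isL1PlusSeq_iff (x := fun i => z (m + i))] at hy
  obtain ⟨hx1, hx2, hx3⟩ := hx
  obtain ⟨hy1, hy2, hy3⟩ := hy
  have hbound : ∀ a : ℕ → ℝ,
      ‖∑ i ∈ Finset.range m, a i • z i‖ ≤ 5 * ‖∑ i ∈ Finset.range (m + n), a i • z i‖ ∧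
      ‖∑ i ∈ Finset.range n, a (m + i) • z (m + i)‖ ≤
        6 * ‖∑ i ∈ Finset.range (m + n), a i • z i‖ := by
    intro a
    rw [Finset.sum_range_add]
    set u := ∑ i ∈ Finset.range m, a i • z i
    set v := ∑ i ∈ Finset.range n, a (m + i) • z (m + i) with hv
    have hvu : ‖v‖ ≤ ‖u + v‖ + ‖u‖ := by simpa using norm_sub_le (u + v) u
    suffices h : ‖u‖ ≤ 5 * ‖u + v‖ from ⟨h, by linarith⟩
    by_cases hu0 : u = 0
    · rw [hu0]
      simp
    have hu : u ∈ Submodule.span ℝ (z '' Set.Iio m) := Submodule.sum_mem _ fun i hi =>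
      Submodule.smul_mem _ _ (Submodule.subset_span ⟨i, Finset.mem_range.1 hi, rfl⟩)
    obtain ⟨j, hj, hj2, hju⟩ := hN u hu hu0
    -- Each coefficient is the norm of a difference of two consecutive basis projections of `v`.
    have hcoef : ∀ i ∈ Finset.range n, |a (m + i)| ≤ 2 * K * ‖v‖ := by
      intro i hi
      rw [Finset.mem_range] at hi
      have h1 := hy2 (fun i => a (m + i)) (i + 1) hi
      have h2 := hy2 (fun i => a (m + i)) i hi.le
      have h3 : a (m + i) • z (m + i) = ∑ k ∈ Finset.range (i + 1), a (m + k) • z (m + k) -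
          ∑ k ∈ Finset.range i, a (m + k) • z (m + k) := by
        rw [Finset.sum_range_succ]
        simp
      have h4 : |a (m + i)| = ‖a (m + i) • z (m + i)‖ := by
        rw [norm_smul, hy1 i hi, mul_one, Real.norm_eq_abs]
      rw [h4, h3]
      exact (norm_sub_le _ _).trans (by linarith)
    have hfv : |f j v| ≤ 1 / 4 * ‖v‖ := by
      calc |f j v| = |∑ i ∈ Finset.range n, a (m + i) * f j (z (m + i))| := by
            rw [hv, map_sum]
            simp
        _ ≤ ∑ i ∈ Finset.range n, |a (m + i) * f j (z (m + i))| := Finset.abs_sum_le_sum_abs _ _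
        _ ≤ ∑ i ∈ Finset.range n, 2 * K * ‖v‖ * δ i := by
            refine Finset.sum_le_sum fun i hi => ?_
            rw [abs_mul]
            exact mul_le_mul (hcoef i hi) (hδ j hj i (Finset.mem_range.1 hi)) (abs_nonneg _)
              (by positivity)
        _ = (2 * K * ∑ i ∈ Finset.range n, δ i) * ‖v‖ := by
            rw [← Finset.mul_sum]
            ring
        _ ≤ _ := by gcongr
    have h1 : f j (u + v) ≤ 2 * ‖u + v‖ :=
      (le_abs_self _).trans ((f j).le_of_opNorm_le hj2 _)
    rw [map_add] at h1
    have h2 := (abs_le.1 hfv).1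
    linarith [norm_nonneg (u + v)]
  refine ⟨fun i hi => ?_, fun a k hk => ?_, fun a ha => ?_⟩
  · rcases lt_or_ge i m with h | h
    · exact hx1 i h
    · obtain ⟨i, rfl⟩ := Nat.exists_eq_add_of_le h
      exact hy1 i (by omega)
  · obtain ⟨h1, h2⟩ := hbound a
    set W := ‖∑ i ∈ Finset.range (m + n), a i • z i‖
    have hW : 0 ≤ W := norm_nonneg _
    rcases le_total k m with h | h
    · have h3 := hx2 a k h
      nlinarith [mul_le_mul_of_nonneg_left h1 (zero_le_one.trans hK)]
    · obtain ⟨k, rfl⟩ := Nat.exists_eq_add_of_le h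
      rw [Finset.sum_range_add]
      have h3 := hy2 (fun i => a (m + i)) k (by omega)
      have h4 := norm_add_le (∑ i ∈ Finset.range m, a i • z i)
        (∑ i ∈ Finset.range k, a (m + i) • z (m + i))
      nlinarith [mul_le_mul_of_nonneg_left h2 (zero_le_one.trans hK)]
  · obtain ⟨h1, h2⟩ := hbound a
    set W := ‖∑ i ∈ Finset.range (m + n), a i • z i‖
    have hK0 : 0 < K := zero_lt_one.trans_le hK
    have h3 := hx3 a ha
    have h4 := hy3 (fun i => a (m + i)) fun i => ha _
    rw [one_div_mul_eq_div, div_le_iff₀ (by positivity)] at h3 h4 ⊢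
    rw [Finset.sum_range_add]
    nlinarith [mul_le_mul_of_nonneg_right h1 hK0.le, mul_le_mul_of_nonneg_right h2 hK0.le]

theorem exists_append_mem_l1PlusLists {f : ℕ → StrongDual ℝ X} (hf : DenseRange f) {K : ℝ}
    (hK : 1 ≤ K) {l₁ : List X} (h₁ : l₁ ∈ l1PlusLists X K) :
    ∃ h : ℕ → ℕ, ∀ l₂ ∈ l1PlusLists X K,
      (∀ i (hi : i < l₂.length), l₂[i] ∈ weakNhd f (h i)) → l₁ ++ l₂ ∈ l1PlusLists X (11 * K) := by
  have hfin : (((fun i => l₁.getD i 0) '' Set.Iio l₁.length)).Finite := (Set.finite_Iio _).image _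
  have := FiniteDimensional.span_of_finite ℝ hfin
  obtain ⟨N, hN⟩ := exists_norming hf
    (Submodule.span ℝ ((fun i => l₁.getD i 0) '' Set.Iio l₁.length))
  obtain ⟨C₀, hC₀⟩ := exists_nat_ge (16 * K)
  set C := max C₀ N
  have hC : 16 * K ≤ C := hC₀.trans (by exact_mod_cast le_max_left _ _)
  have hCpos : (0 : ℝ) < C := by linarith
  -- `C ≥ N` brings the functionals `f 0, …, f N` under control; the bounds `2⁻ⁱ / C` sum to at most
  -- `2 / C`, and `C ≥ 16 K` makes `4 K / C ≤ 1 / 4`.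
  refine ⟨fun i => C * 2 ^ i, fun l₂ h₂ hl₂ => ?_⟩
  let z : ℕ → X := fun i => (l₁ ++ l₂).getD i 0
  have hz : ∀ i (hi : i < (l₁ ++ l₂).length), (l₁ ++ l₂)[i] = z i := fun i hi =>
    (List.getD_eq_getElem _ _ hi).symm
  have hz₁ : ∀ i < l₁.length, z i = l₁.getD i 0 := fun i hi => by
    simp only [z]
    rw [List.getD_append _ _ _ _ hi]
  have hz₂ : ∀ i (hi : i < l₂.length), l₂[i] = z (l₁.length + i) := fun i hi => by
    simp [z, hi]
  rw [mem_l1PlusLists_iff hz, List.length_append]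
  refine isL1PlusSeq_add (δ := fun i => 1 / C * (1 / 2) ^ i) (f := f) (N := N) hK ?_ ?_ ?_ ?_ ?_
  · rwa [← mem_l1PlusLists_iff]
    intro i hi
    rw [hz₁ i hi]
    simp [hi]
  · rwa [← mem_l1PlusLists_iff (x := fun i => z (l₁.length + i)) hz₂]
  · have : z '' Set.Iio l₁.length = (fun i => l₁.getD i 0) '' Set.Iio l₁.length :=
      Set.image_congr hz₁
    rwa [this]
  · intro j hj i hi
    rw [← hz₂ i hi]
    have hle : N ≤ C * 2 ^ i :=
      (le_max_right _ _).trans (Nat.le_mul_of_pos_right _ (by positivity))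
    refine ((hl₂ i hi).2 j (hj.trans hle)).le.trans ?_
    push_cast
    rw [one_div_pow, one_div_mul_one_div]
    gcongr
    linarith
  · rw [← Finset.mul_sum]
    have h2 := sum_geometric_two_le l₂.length
    have h3 : (1 : ℝ) / C * ∑ i ∈ Finset.range l₂.length, (1 / 2 : ℝ) ^ i ≤ 1 / C * 2 := by
      gcongr
    calc 2 * K * (1 / C * ∑ i ∈ Finset.range l₂.length, (1 / 2 : ℝ) ^ i)
        ≤ 2 * K * (1 / C * 2) := by gcongr
      _ = 4 * K / C := by ring
      _ ≤ 1 / 4 := by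
        rw [div_le_iff₀ hCpos]
        linarith

/-- A sequence with a uniform lower estimate on its non-negative combinations cannot be close to
a weakly null sequence. -/
theorem not_weaklyNull_of_lower_estimate {s w : ℕ → X} {ρ ε : ℝ} (hρ : 0 < ρ) (hε : ε < ρ)
    (hs : ∀ (n : ℕ) (a : ℕ → ℝ), (∀ i, 0 ≤ a i) →
      ρ * ∑ i ∈ Finset.range n, a i ≤ ‖∑ i ∈ Finset.range n, a i • s i‖)
    (hw : ∀ i, ‖w i - s i‖ ≤ ε) : ¬ WeaklyNull w := by
  intro hnull
  -- The lower estimate keeps the convex hull of `s` off the `ρ`-ball. A separating `g` is at least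
  -- `ρ ‖g‖` on `s`, hence at least `(ρ - ε) ‖g‖ > 0` on `w`.
  have hdisj : Disjoint (Metric.ball (0 : X) ρ) (convexHull ℝ (Set.range s)) := by
    rw [Set.disjoint_left]
    intro x hxρ hx
    obtain ⟨ι, _, a, z, ha, ha1, hz, rfl⟩ := mem_convexHull_iff_exists_fintype.1 hx
    choose k hk using hz
    let n := Finset.univ.sup k + 1
    have hkn : ∀ i ∈ Finset.univ, k i ∈ Finset.range n := fun i hi =>
      Finset.mem_range.2 (Nat.lt_succ_of_le (Finset.le_sup hi))
    have h1 : ∑ j ∈ Finset.range n, (∑ i with k i = j, a i) = 1 := by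
      rw [Finset.sum_fiberwise_of_maps_to hkn, ha1]
    have h2 : ∑ j ∈ Finset.range n, (∑ i with k i = j, a i) • s j = ∑ i, a i • z i := by
      rw [← Finset.sum_fiberwise_of_maps_to hkn fun i => a i • z i]
      refine Finset.sum_congr rfl fun j _ => ?_
      rw [Finset.sum_smul]
      refine Finset.sum_congr rfl fun i hi => ?_
      rw [← hk i, (Finset.mem_filter.1 hi).2]
    have h3 := hs n (fun j => ∑ i with k i = j, a i) fun j => Finset.sum_nonneg fun i _ => ha i
    rw [h1, h2, mul_one] at h3
    rw [mem_ball_zero_iff] at hxρ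
    exact absurd hxρ (not_lt.2 h3)
  obtain ⟨g, u, hgb, hgs⟩ := geometric_hahn_banach_open (convex_ball (0 : X) ρ)
    Metric.isOpen_ball (convex_convexHull ℝ _) hdisj
  have hu : 0 < u := by simpa using hgb 0 (by simpa using hρ)
  have hgu : ρ * ‖g‖ ≤ u := by
    by_contra! h
    rw [mul_comm, ← div_lt_iff₀ hρ] at h
    obtain ⟨x, hx, hlt⟩ := g.exists_lt_apply_of_lt_opNorm h
    rw [div_lt_iff₀ hρ, Real.norm_eq_abs] at hlt
    have hb : ∀ t : ℝ, |t| = ρ → t * g x < u := by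
      intro t ht
      have := hgb (t • x) (by
        rw [mem_ball_zero_iff, norm_smul, Real.norm_eq_abs, ht]
        exact mul_lt_of_lt_one_right hρ hx)
      simpa using this
    rcases abs_cases (g x) with ⟨h, -⟩ | ⟨h, -⟩
    · have := hb ρ (abs_of_pos hρ)
      rw [h] at hlt
      linarith
    · have := hb (-ρ) (by rw [abs_neg, abs_of_pos hρ])
      rw [h] at hlt
      linarith
  have hlow : ∀ i, u - ε * ‖g‖ ≤ g (w i) := by
    intro i
    have h1 := hgs (s i) (subset_convexHull ℝ _ ⟨i, rfl⟩)
    have h2 : |g (w i - s i)| ≤ ‖g‖ * ε := g.le_of_opNorm_le_of_le le_rfl (hw i)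
    rw [map_sub] at h2
    linarith [(abs_le.1 h2).1]
  have hlim := ge_of_tendsto' (hnull g) hlow
  have hg0 : 0 < ‖g‖ := by
    rw [norm_pos_iff]
    rintro rfl
    have := hgs (s 0) (subset_convexHull ℝ _ ⟨0, rfl⟩)
    simp at this
    linarith
  nlinarith

theorem exists_not_extendable [TopologicalSpace.SeparableSpace X] {f : ℕ → StrongDual ℝ X}
    (hf : DenseRange f) {K : ℝ} (hK : 1 ≤ K) :
    ∃ α < ω₁, ¬ Extendable (l1PlusLists X K) (weakNhd f) α [] := by
  by_contra! hcon
  have hK0 : 0 < K := zero_lt_one.trans_le hK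
  let d := TopologicalSpace.denseSeq X
  have hd : ∀ N, ∀ y ∈ weakNhd f N, ∃ k, dist y (d k) < 1 / (4 * K) := fun N y _ =>
    (TopologicalSpace.denseRange_denseSeq X).exists_dist_lt y (by positivity)
  obtain ⟨s, hs⟩ := exists_seq_of_extendable hd hcon
  choose l hl hlen hls using hs
  -- The lists `l n` need not extend one another; only `s` is common to them. The last entry of `l
  -- (n + 1)` lies in `weakNhd f n` and is close to `d (s n)`, so these entries form a weakly null
  -- sequence near `s`.
  let w : ℕ → X := fun n => (l (n + 1))[n]'(by rw [hlen]; exact n.lt_succ_self)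
  have hw : ∀ n, w n ∈ weakNhd f n ∧ dist (w n) (d (s n)) < 1 / (4 * K) := fun n =>
    hls (n + 1) n _
  refine not_weaklyNull_of_lower_estimate (s := fun i => d (s i)) (w := w) (ρ := 3 / (4 * K))
    (ε := 1 / (4 * K)) (by positivity) (by gcongr; norm_num) ?_ ?_ ?_
  · intro n a ha
    have hx := hl n
    rw [mem_l1PlusLists_iff (x := fun i => (l n).getD i 0) (fun i hi => by simp [hi]),
      isL1PlusSeq_iff (x := fun i => (l n).getD i 0), hlen] at hx
    have h1 := hx.2.2 a ha
    have h2 : ‖∑ i ∈ Finset.range n, a i • (l n).getD i 0 -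
        ∑ i ∈ Finset.range n, a i • d (s i)‖ ≤ 1 / (4 * K) * ∑ i ∈ Finset.range n, a i := by
      rw [← Finset.sum_sub_distrib, Finset.mul_sum]
      refine norm_sum_le_of_le _ fun i hi => ?_
      have hi' : i < (l n).length := by rw [hlen]; exact Finset.mem_range.1 hi
      have h3 := (hls n i hi').2
      rw [dist_eq_norm] at h3
      rw [← smul_sub, norm_smul, Real.norm_eq_abs, abs_of_nonneg (ha i), mul_comm,
        List.getD_eq_getElem _ _ hi']
      exact mul_le_mul_of_nonneg_right h3.le (ha i)
    have h4 := norm_sub_norm_le (∑ i ∈ Finset.range n, a i • (l n).getD i 0)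
      (∑ i ∈ Finset.range n, a i • d (s i))
    have h5 : 3 / (4 * K) * ∑ i ∈ Finset.range n, a i = 1 / K * ∑ i ∈ Finset.range n, a i -
        1 / (4 * K) * ∑ i ∈ Finset.range n, a i := by
      field_simp
      ring
    linarith
  · intro i
    rw [← dist_eq_norm]
    exact (hw i).2.le
  · refine weaklyNull_of_eventually hf fun N => ?_
    filter_upwards [Filter.eventually_ge_atTop N] with i hi
    exact antitone_weakNhd f hi (hw i).1

end L1Plus


/-! ### The index: countability and closure under addition -/

section Index

variable {f : ℕ → StrongDual ℝ X}
  {c : LimitSequences} {K : ℝ}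

theorem IsL1PlusWeaklyNullTree.extendable {T : Set (List X)}
    (h : IsL1PlusWeaklyNullTree c K T) :
    order T < ω₁ ∧ Extendable (l1PlusLists X K) (weakNhd f) (order T) [] := by
  obtain ⟨⟨hT, ⟨α, hα, hiso⟩, hw⟩, hl⟩ := h
  rw [hiso.order_eq hα]
  refine ⟨hα, hiso.extendable hα hT.2 (isNullAlong_of_weaklyNull hiso ?_ hT.2 hw) hl
    (nil_mem_l1PlusLists K)⟩
  intro l hlT x hx
  obtain ⟨i, rfl⟩ := List.get_of_mem hx
  exact (hl l hlT).1 i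

theorem Extendable.exists_isL1PlusWeaklyNullTree (c : LimitSequences) (hf : DenseRange f)
    {α : Ordinal.{0}} (h0 : α ≠ 0) (hα : α < ω₁)
    (h : Extendable (l1PlusLists X K) (weakNhd f) α []) :
    ∃ T : Set (List X), IsL1PlusWeaklyNullTree c K T ∧ order T = α := by
  obtain ⟨T, hT, hiso, hnull, hTF⟩ := h.exists_isIsoSTree c h0 hα (antitone_weakNhd f)
    (exists_notMem_weakNhd hf)
  exact ⟨T, ⟨⟨hT, ⟨α, hα, hiso⟩, fun y hy => hnull.weaklyNull hf hy⟩, hTF⟩, hiso.order_eq hα⟩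

theorem bddAbove_order_trees (c : LimitSequences) (K : ℝ) :
    BddAbove {o | ∃ T : Set (List X), IsL1PlusWeaklyNullTree c K T ∧ o = order T} := by
  refine ⟨ω₁, ?_⟩
  rintro _ ⟨T, ⟨⟨-, ⟨α, hα, hiso⟩, -⟩, -⟩, rfl⟩
  rw [hiso.order_eq hα]
  exact hα.le

theorem le_l1PlusWeaklyNullIndex (c : LimitSequences) (hf : DenseRange f) (hK : 1 ≤ K)
    {α : Ordinal.{0}} (hα : α < ω₁)
    (h : Extendable (l1PlusLists X K) (weakNhd f) α []) : α ≤ l1PlusWeaklyNullIndex X c := by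
  rcases eq_or_ne α 0 with rfl | h0
  · exact zero_le
  obtain ⟨T, hT, rfl⟩ := h.exists_isL1PlusWeaklyNullTree c hf h0 hα
  exact (le_csSup (bddAbove_order_trees c K) ⟨T, hT, rfl⟩).trans
    (Ordinal.le_iSup (fun K : Set.Ici (1 : ℝ) => l1PlusWeaklyNullIndexWith X c K) ⟨K, hK⟩)

theorem exists_extendable_of_lt {β : Ordinal.{0}} (h : β < l1PlusWeaklyNullIndex X c) :
    ∃ K : ℝ, 1 ≤ K ∧ ∃ α < ω₁, β < α ∧ Extendable (l1PlusLists X K) (weakNhd f) α [] := by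
  obtain ⟨⟨K, hK⟩, hβK⟩ := Ordinal.lt_iSup_iff.1 h
  by_contra! hcon
  refine absurd hβK (not_lt.2 (csSup_le' ?_))
  rintro _ ⟨T, hT, rfl⟩
  by_contra! hlt
  obtain ⟨h1, h2⟩ := hT.extendable (f := f)
  exact hcon K hK _ h1 hlt h2

theorem l1PlusWeaklyNullIndex_lt_omega_one [TopologicalSpace.SeparableSpace X]
    (c : LimitSequences) (hf : DenseRange f) : l1PlusWeaklyNullIndex X c < ω₁ := by
  choose α hα hn using fun n : ℕ => exists_not_extendable (X := X) hf (K := (n : ℝ) + 1)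
    (by simp)
  have hsup : ⨆ n, α n < ω₁ := Ordinal.iSup_lt_omega_one hα
  refine lt_of_le_of_lt (not_lt.1 fun hlt => ?_) hsup
  obtain ⟨K, hK, β, -, hβ, h⟩ := exists_extendable_of_lt (f := f) hlt
  obtain ⟨n, hn'⟩ := exists_nat_ge K
  exact hn n ((h.mono (l1PlusLists_mono (by linarith) (by linarith))).anti
    ((Ordinal.le_iSup α n).trans hβ.le))

theorem l1PlusWeaklyNullIndex_pos (hinf : ¬ FiniteDimensional ℝ X) (c : LimitSequences)
    (hf : DenseRange f) : 0 < l1PlusWeaklyNullIndex X c := by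
  refine zero_lt_one.trans_le (le_l1PlusWeaklyNullIndex c hf (K := 1) le_rfl
    (Ordinal.one_lt_omega0.trans Ordinal.omega0_lt_omega_one)
    (extendable_iff.2 ⟨nil_mem_l1PlusLists 1, fun β hβ N => ?_⟩))
  obtain ⟨y, hy⟩ := weakNhd_nonempty hinf f N
  refine ⟨y, hy, extendable_iff.2 ⟨singleton_mem_l1PlusLists hy.1, fun γ hγ => ?_⟩⟩
  rw [Order.lt_one_iff] at hβ
  exact absurd (hβ ▸ hγ) not_lt_zero

theorem isPrincipal_add_l1PlusWeaklyNullIndex (c : LimitSequences) (hf : DenseRange f) :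
    Ordinal.IsPrincipal (· + ·) (l1PlusWeaklyNullIndex X c) := by
  have hdouble : ∀ β < l1PlusWeaklyNullIndex X c, β + β < l1PlusWeaklyNullIndex X c := by
    intro β hβ
    obtain ⟨K, hK, α, hα, hβα, h⟩ := exists_extendable_of_lt (f := f) hβ
    have h2 : Extendable (l1PlusLists X (11 * K)) (weakNhd f) (α + α) [] :=
      Extendable.add (antitone_weakNhd f)
        (fun l hl => exists_append_mem_l1PlusLists hf hK hl) h h
    have hαα : α + α < ω₁ := Ordinal.isPrincipal_add_omega 1 hα hα
    -- Strictness comes from `β < α`: the index may be a supremum that is not attained, but `α + α`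
    -- is at most the index.
    exact (add_lt_add_of_le_of_lt hβα.le hβα).trans_le
      (le_l1PlusWeaklyNullIndex c hf (by linarith) hαα h2)
  intro β γ hβ hγ
  exact (add_le_add (le_max_left β γ) (le_max_right β γ)).trans_lt (hdouble _ (max_lt hβ hγ))

end Index

end WeaklyNullIndex

theorem theorem3p12 {X : Type*} [NormedAddCommGroup X] [NormedSpace ℝ X] [CompleteSpace X]
    (hinf : ¬ FiniteDimensional ℝ X)
    (hsep : TopologicalSpace.SeparableSpace (StrongDual ℝ X))
    (c : WeaklyNullIndex.LimitSequences) :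
    WeaklyNullIndex.l1PlusWeaklyNullIndex X c < ω₁ ∧
      ∃ α : Ordinal.{0}, α < ω₁ ∧ WeaklyNullIndex.l1PlusWeaklyNullIndex X c = ω ^ α := by
  have hf := TopologicalSpace.denseRange_denseSeq (StrongDual ℝ X)
  have : TopologicalSpace.SeparableSpace X := WeaklyNullIndex.separableSpace_of_strongDual
  have hlt := WeaklyNullIndex.l1PlusWeaklyNullIndex_lt_omega_one (X := X) c hf
  refine ⟨hlt, ?_⟩
  rcases Ordinal.isPrincipal_add_iff_zero_or_omega0_opow.1
    (WeaklyNullIndex.isPrincipal_add_l1PlusWeaklyNullIndex (X := X) c hf) with h | ⟨α, hα⟩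
  · exact absurd h (WeaklyNullIndex.l1PlusWeaklyNullIndex_pos hinf c hf).ne'
  · refine ⟨α, ?_, hα.symm⟩
    rw [← hα] at hlt
    exact (Ordinal.right_le_opow α Ordinal.one_lt_omega0).trans_lt hlt
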